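/- For $0<\alpha<\pi/2$ put $S_\alpha=\{z\in\mathbb C:\operatorname{Re}z>0,\ |\arg z|<\alpha\}$ and $V_\alpha=\{z\in\mathbb C:\operatorname{Re}z>0,\ |\arg z|\le\alpha\}$. Let $0<\beta<\alpha<\pi/2$ and let $X$ be a complex Banach space. Let $(T(t))_{t\in S_\alpha}$ be a nontrivial (that is, not identically zero) bounded analytic semigroup of quasinilpotent operators on $X$: the map $T:S_\alpha\to\mathcal B(X)$ is analytic, $T(s+t)=T(s)T(t)$ for all $s,t\in S_\alpha$, $\sup_{t\in S_\alpha}\|T(t)\|<\infty$, and every $T(t)$ has spectral radius $0$. Let $\mu$ be a complex Borel measure supported on a compact set $K\subset V_\beta$ with $\int_K d\mu=0$, and let $$F(z)=\int_K e^{-z\xi}\,d\mu(\xi)\qquad(z\in\mathbb C)$$ be its Fourier--Borel transform. Put $\widetilde F(z)=\overline{F(\overline z)}$, which is the Fourier--Borel transform of the measure $\overline\mu$ given by $\overline\mu(S)=\overline{\mu(\overline S)}$, where $\overline S=\{\overline z: z\in S\}$. For $u\in S_{\alpha-\beta}$ define the Bochner integrals $$F(-uA)=\int T(u\xi)\,d\mu(\xi),\qquad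 \widetilde F(-uA)=\int T(u\xi)\,d\overline\mu(\xi)$$ in $\mathcal B(X)$ (here $A$ stands for the generator of the semigroup). Then $\sup_{t>0}|F(t)|^2$ is finite, and there is an $\eta>0$ such that $$\|F(-uA)\,\widetilde F(-uA)\|\ \ge\ \sup_{t>0}|F(t)|^2$$ for all $u\in S_{\alpha-\beta}$ with $|u|\le\eta$. -/

import Mathlib

open MeasureTheory

namespace SectorSemigroup

/-- The open sector `S_α = {z : Re z > 0, |arg z| < α}`. -/
def openSector (α : ℝ) : Set ℂ := {z | 0 < z.re ∧ |z.arg| < α}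

/-- The sector `V_β = {z : Re z > 0, |arg z| ≤ β}`. It does not contain the origin. -/
def closedSector (β : ℝ) : Set ℂ := {z | 0 < z.re ∧ |z.arg| ≤ β}

/-- An analytic semigroup of bounded operators on `X` over the sector `S_α`. Only the values of
`T` on the sector matter. No continuity at the origin is required. -/
structure IsAnalyticSemigroup {X : Type*} [NormedAddCommGroup X] [NormedSpace ℂ X]
    (α : ℝ) (T : ℂ → X →L[ℂ] X) : Prop where
  analytic : DifferentiableOn ℂ T (openSector α)
  map_add : ∀ s ∈ openSector α, ∀ t ∈ openSector α, T (s + t) = T s * T t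

/-- A complex measure has finite total variation, so bounded continuous functions are integrable
against it. -/
theorem isFiniteMeasure_variation {Ω : Type*} [MeasurableSpace Ω] (μ : ComplexMeasure Ω) :
    IsFiniteMeasure μ.variation := by
  have h : μ.variation ≤ (ComplexMeasure.re μ).totalVariation
      + (ComplexMeasure.im μ).totalVariation := by
    refine VectorMeasure.variation_le_of_forall_enorm_le fun s _ => ?_
    have h1 := (ComplexMeasure.re μ).enorm_le_totalVariation s
    have h2 := (ComplexMeasure.im μ).enorm_le_totalVariation s
    rw [Measure.add_apply]
    refine le_trans ?_ (add_le_add h1 h2)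
    have e1 : ComplexMeasure.re μ s = (μ s).re := rfl
    have e2 : ComplexMeasure.im μ s = (μ s).im := rfl
    rw [e1, e2, ← ofReal_norm, ← ofReal_norm, ← ofReal_norm,
      ← ENNReal.ofReal_add (norm_nonneg _) (norm_nonneg _)]
    exact ENNReal.ofReal_le_ofReal (Complex.norm_le_abs_re_add_abs_im _)
  exact isFiniteMeasure_of_le _ h

/-- The integral `∫ f dμ` of a Banach space valued function against a complex measure: Mathlib's
integral against a vector measure, for the pairing `(x, c) ↦ c • x`. -/
noncomputable def cintegral {E : Type*} [NormedAddCommGroup E] [NormedSpace ℂ E]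
    (μ : ComplexMeasure ℂ) (f : ℂ → E) : E :=
  μ.integral f (ContinuousLinearMap.lsmul ℝ ℂ : ℂ →L[ℝ] E →L[ℝ] E).flip

/-- A function that is continuous on a compact set carrying a complex measure is integrable, so
that the integrals below are genuine ones. -/
theorem integrable_of_continuousOn {E : Type*} [NormedAddCommGroup E] (μ : ComplexMeasure ℂ)
    {K : Set ℂ} (hK : IsCompact K) (hμ : μ.variation Kᶜ = 0) {f : ℂ → E}
    (hf : ContinuousOn f K) : μ.Integrable f := by
  have := isFiniteMeasure_variation μ
  have h : μ.variation.restrict K = μ.variation :=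
    Measure.restrict_eq_self_of_ae_mem (by rw [ae_iff]; exact hμ)
  have h' : IntegrableOn f K μ.variation := hf.integrableOn_compact hK
  rwa [IntegrableOn, h] at h'

/-- The Fourier–Borel transform `F(z) = ∫ exp (-z ξ) dμ(ξ)`. -/
noncomputable def fourierBorel (μ : ComplexMeasure ℂ) (z : ℂ) : ℂ :=
  cintegral μ (fun ξ => Complex.exp (-(z * ξ)))

/-- The operator `F(-uA) = ∫ T(u ξ) dμ(ξ)`, where `F` is the Fourier–Borel transform of `μ`
and `A` is the generator of `T`. -/
noncomputable def funcCalc {X : Type*} [NormedAddCommGroup X] [NormedSpace ℂ X]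
    (T : ℂ → X →L[ℂ] X) (μ : ComplexMeasure ℂ) (u : ℂ) : X →L[ℂ] X :=
  cintegral μ (fun ξ => T (u * ξ))

/-- The conjugate measure `S ↦ conj (μ (conj S))`. -/
noncomputable def conjMeasure (μ : ComplexMeasure ℂ) : ComplexMeasure ℂ :=
  (μ.mapRange (starRingEnd ℂ : ℂ →+ ℂ)
    (by simpa using Complex.continuous_conj)).map (starRingEnd ℂ)

theorem conjMeasure_apply (μ : ComplexMeasure ℂ) {s : Set ℂ} (hs : MeasurableSet s) :
    conjMeasure μ s = starRingEnd ℂ (μ ((starRingEnd ℂ) ⁻¹' s)) := by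
  rw [conjMeasure, VectorMeasure.map_apply _ Complex.continuous_conj.measurable hs,
    VectorMeasure.mapRange_apply]
  simp

/-- The Fourier–Borel transform of the conjugate measure is `z ↦ conj (F (conj z))`. -/
theorem fourierBorel_conjMeasure (μ : ComplexMeasure ℂ) (z : ℂ) :
    fourierBorel (conjMeasure μ) z = starRingEnd ℂ (fourierBorel μ (starRingEnd ℂ z)) := by
  have hemb : MeasurableEmbedding (starRingEnd ℂ : ℂ → ℂ) :=
    Complex.conjLIE.toHomeomorph.measurableEmbedding
  set ν : ComplexMeasure ℂ :=
    μ.mapRange (starRingEnd ℂ : ℂ →+ ℂ)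
    (by simpa using Complex.continuous_conj) with hν
  have happ : ∀ s, ν s = starRingEnd ℂ (μ s) := fun s => VectorMeasure.mapRange_apply _ _
  have hvar : ν.variation = μ.variation := by
    apply le_antisymm
    · refine VectorMeasure.variation_le_of_forall_enorm_le fun s _ => ?_
      rw [happ, ← ofReal_norm, RCLike.norm_conj, ofReal_norm]
      exact VectorMeasure.enorm_measure_le_variation _ _
    · refine VectorMeasure.variation_le_of_forall_enorm_le fun s _ => ?_
      rw [← ofReal_norm, ← RCLike.norm_conj, ← happ, ofReal_norm]
      exact VectorMeasure.enorm_measure_le_variation _ _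
  have key : ∀ g : ℂ → ℂ, μ.Integrable g →
      cintegral ν (fun x => starRingEnd ℂ (g x)) = starRingEnd ℂ (cintegral μ g) := by
    intro g hg
    have h1 := VectorMeasure.integral_continuousLinearMap_comp (μ := ν) (f := g)
      (B := (ContinuousLinearMap.lsmul ℝ ℂ : ℂ →L[ℝ] ℂ →L[ℝ] ℂ).flip)
      (C := (Complex.conjCLE : ℂ →L[ℝ] ℂ)) (by rw [hvar]; exact hg)
    have h2 := VectorMeasure.continuousLinearMap_apply_integral (μ := μ) (f := g)
      (B := (ContinuousLinearMap.lsmul ℝ ℂ : ℂ →L[ℝ] ℂ →L[ℝ] ℂ).flip)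
      (C := (Complex.conjCLE : ℂ →L[ℝ] ℂ)) hg
    have h3 : ∀ (B B' : ℂ →L[ℝ] ℂ →L[ℝ] ℂ), (∀ s x, B x (ν s) = B' x (μ s)) →
        ν.integral g B = μ.integral g B' := by
      intro B B' h
      rw [VectorMeasure.integral_eq_setToFun, VectorMeasure.integral_eq_setToFun]
      have hd : DominatedFinMeasAdditive μ.variation (ν.transpose B) ‖B‖ :=
        hvar ▸ dominatedFinMeasAdditive_cbmApplyMeasure ν B
      rw [setToFun_congr_measure (μ' := μ.variation) 1 1 (by simp) (by simp)
        (by simp [hvar]) (by simp [hvar]) _ hd]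
      refine setToFun_congr_left _ _ ?_ _
      funext s
      exact ContinuousLinearMap.ext fun x => h s x
    exact h1.trans ((h3 _ _ fun s x => by simp [happ]).trans h2.symm)
  have hmap : fourierBorel (conjMeasure μ) z
      = cintegral ν (fun ξ => Complex.exp (-(z * starRingEnd ℂ ξ))) :=
    hemb.integral_map_vectorMeasure
  have hfun : (fun ξ : ℂ => Complex.exp (-(z * starRingEnd ℂ ξ)))
      = fun ξ => starRingEnd ℂ (Complex.exp (-(starRingEnd ℂ z * ξ))) := by
    funext ξ
    rw [← Complex.exp_conj]
    simp
  rw [hmap, hfun, fourierBorel]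
  by_cases hint : μ.Integrable fun ξ => Complex.exp (-(starRingEnd ℂ z * ξ))
  · exact key _ hint
  · have hint' : ¬ ν.Integrable fun ξ => starRingEnd ℂ (Complex.exp (-(starRingEnd ℂ z * ξ))) := by
      intro h
      apply hint
      have h' := (Complex.conjCLE : ℂ →L[ℝ] ℂ).integrable_comp h
      rw [hvar] at h'
      simpa using h'
    rw [cintegral, cintegral, VectorMeasure.integral_undef hint',
      VectorMeasure.integral_undef hint, map_zero]

end SectorSemigroup

namespace SectorSemigroup

open Set Filter Topology

/-! ### Integration against a complex measure. -/

section Integral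

variable {E G : Type*} [NormedAddCommGroup E] [NormedSpace ℂ E] [NormedAddCommGroup G]
  [NormedSpace ℂ G] {μ : ComplexMeasure ℂ} {K : Set ℂ}

/-! Idea of the whole proof. Write `-A` for the generator and `R z = (A - z)⁻¹`, formally the
integral of `exp (z t) • T t` over `(0, ∞)`. Quasinilpotence makes `R` entire
(`exists_entire_resolvent`). Put `H z = F z * conj (F (conj z))` and `c = sup |F t|²` over `t > 0`.
If `F` is not identically zero on the positive axis, then `c` is positive and attained at some `x₀ >
0`, because `F 0 = 0` and `F` decays along the axis.

Suppose the inequality fails for arbitrarily small `u`. At scale `u` the operator `F(-uA)` acts on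
`R (z / u)` almost as the scalar `F z`, with error `O(|u|)` locally uniformly in `z`. For the bad
`u` this gives `‖R (z / u)‖ * (|H z| - c) ≤ C(|z|) |u|` (`norm_resolvent_mul_sub_le`), so `R (z / u)
= O(|u|)` wherever `|H| > c`. The same bound holds on the half planes `Re (z exp (iθ)) < 0`, `|θ| ≤
β`, where `exp (z v) • T (u v)` has norm at most `1/2` for a large `v` of argument `θ`
(`norm_resolvent_le_of_norm_semigroup_le`).

These regions contain a loop around `0`, except for its starting point `x₀`. A ray leaves `x₀` into
the part of `{|H| > c}` in the upper half plane (`exists_ray_norm_ge`); by Phragmén–Lindelöf the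
component reached meets a good half plane (`exists_mem_component_halfPlane`); reflection in the real
axis closes the loop. At `x₀` the bound blows up only polynomially, which a factor `(z - x₀) ^ k`
absorbs. Cauchy's formula at `0` then gives `‖R 0‖ = O(|u|)`, hence `R 0 = 0`. So every integral of
`T` from `0` to `s` vanishes, and `T = 0`, a contradiction. -/

theorem norm_cintegral_le (hμ : μ.variation Kᶜ = 0) {f : ℂ → E} {C : ℝ} (hC0 : 0 ≤ C)
    (hC : ∀ ξ ∈ K, ‖f ξ‖ ≤ C) : ‖cintegral μ f‖ ≤ C * μ.variation.real univ := by
  have := isFiniteMeasure_variation μ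
  have hae : ∀ᵐ x ∂μ.variation, x ∈ K := by rw [ae_iff]; exact hμ
  have h1 : ‖cintegral μ f‖ ≤ C * ‖(ContinuousLinearMap.lsmul ℝ ℂ : ℂ →L[ℝ] E →L[ℝ] E).flip‖
      * μ.variation.real univ := by
    refine VectorMeasure.norm_integral_le_of_norm_le_const ?_
    filter_upwards [hae] with x hx using hC x hx
  refine h1.trans ?_
  have h2 : ‖(ContinuousLinearMap.lsmul ℝ ℂ : ℂ →L[ℝ] E →L[ℝ] E).flip‖ ≤ 1 := by
    rw [ContinuousLinearMap.opNorm_flip]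
    exact ContinuousLinearMap.opNorm_lsmul_le
  gcongr
  exact mul_le_of_le_one_right hC0 h2

theorem cintegral_sub {f g : ℂ → E} (hf : μ.Integrable f) (hg : μ.Integrable g) :
    cintegral μ (fun ξ => f ξ - g ξ) = cintegral μ f - cintegral μ g :=
  VectorMeasure.integral_fun_sub hf hg

theorem cintegral_comp [CompleteSpace E] [CompleteSpace G] (L : E →L[ℂ] G) {f : ℂ → E}
    (hf : μ.Integrable f) : cintegral μ (fun ξ => L (f ξ)) = L (cintegral μ f) := by
  have h1 := VectorMeasure.integral_continuousLinearMap_comp (μ := μ) (f := f)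
    (B := (ContinuousLinearMap.lsmul ℝ ℂ : ℂ →L[ℝ] G →L[ℝ] G).flip)
    (C := L.restrictScalars ℝ) hf
  have h2 := VectorMeasure.continuousLinearMap_apply_integral (μ := μ) (f := f)
    (B := (ContinuousLinearMap.lsmul ℝ ℂ : ℂ →L[ℝ] E →L[ℝ] E).flip)
    (C := L.restrictScalars ℝ) hf
  refine h1.trans (Eq.trans ?_ h2.symm)
  congr 1
  ext x c
  simp

theorem cintegral_one [CompleteSpace E] (c : E) : cintegral μ (fun _ => c) = μ univ • c := by
  have := isFiniteMeasure_variation μ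
  exact (VectorMeasure.integral_const c).trans (by simp)

theorem variation_conjMeasure_compl (hK : IsCompact K) (hμ : μ.variation Kᶜ = 0) :
    (conjMeasure μ).variation (starRingEnd ℂ ⁻¹' K)ᶜ = 0 := by
  have hm : MeasurableSet (starRingEnd ℂ ⁻¹' K)ᶜ :=
    (Complex.continuous_conj.measurable hK.isClosed.measurableSet).compl
  have hle : (conjMeasure μ).variation ≤ μ.variation.map (starRingEnd ℂ) := by
    refine VectorMeasure.variation_le_of_forall_enorm_le fun s hs => ?_
    rw [conjMeasure_apply μ hs, Measure.map_apply Complex.continuous_conj.measurable hs,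
      ← ofReal_norm, RCLike.norm_conj, ofReal_norm]
    exact VectorMeasure.enorm_measure_le_variation _ _
  refine le_antisymm ((hle _).trans ?_) zero_le
  rw [Measure.map_apply Complex.continuous_conj.measurable hm]
  refine le_trans (measure_mono ?_) hμ.le
  intro x hx
  simpa using hx

theorem measure_univ_eq_zero (hK : IsCompact K) (hμ : μ.variation Kᶜ = 0) (h0 : μ K = 0) :
    μ univ = 0 := by
  have hm := hK.isClosed.measurableSet
  rw [← union_compl_self K, VectorMeasure.of_union disjoint_compl_right hm hm.compl, h0, zero_add]
  have := VectorMeasure.enorm_measure_le_variation μ Kᶜ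
  rw [hμ] at this
  simpa using this

end Integral

/-! ### The Fourier–Borel transform as an entire function. -/

section FourierBorel

variable {μ : ComplexMeasure ℂ} {K : Set ℂ}

theorem integrable_exp (hK : IsCompact K) (hμ : μ.variation Kᶜ = 0) (z : ℂ) :
    μ.Integrable fun ξ => Complex.exp (-(z * ξ)) :=
  integrable_of_continuousOn μ hK hμ (by fun_prop)

theorem fourierBorel_zero (hK : IsCompact K) (hμ : μ.variation Kᶜ = 0) (h0 : μ K = 0) :
    fourierBorel μ 0 = 0 := by
  have h := cintegral_one (μ := μ) (1 : ℂ)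
  rw [measure_univ_eq_zero hK hμ h0, zero_smul] at h
  simpa [fourierBorel] using h

theorem norm_fourierBorel_le (hμ : μ.variation Kᶜ = 0) {z : ℂ} {δ : ℝ}
    (h : ∀ ξ ∈ K, δ ≤ (z * ξ).re) :
    ‖fourierBorel μ z‖ ≤ Real.exp (-δ) * μ.variation.real univ := by
  refine norm_cintegral_le hμ (Real.exp_pos _).le fun ξ hξ => ?_
  rw [Complex.norm_exp]
  exact Real.exp_le_exp.2 (by rw [Complex.neg_re]; exact neg_le_neg (h ξ hξ))

/-- Differentiation under the integral, done by hand: on the bounded set `K` the second-order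
remainder of the exponential is uniformly `O(|h|²)`. -/
theorem differentiable_fourierBorel (hK : IsCompact K) (hμ : μ.variation Kᶜ = 0) :
    Differentiable ℂ (fourierBorel μ) := by
  obtain ⟨ρ, hρ⟩ := hK.isBounded.exists_norm_le
  intro z
  set D : ℂ := cintegral μ fun ξ => -ξ * Complex.exp (-(z * ξ)) with hD
  have hint : μ.Integrable fun ξ : ℂ => -ξ * Complex.exp (-(z * ξ)) :=
    integrable_of_continuousOn μ hK hμ (by fun_prop)
  set r : ℝ := |ρ| + 1 with hr
  have hr1 : 1 ≤ r := by simp [hr]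
  have hKr : ∀ ξ ∈ K, ‖ξ‖ ≤ r := fun ξ hξ =>
    (hρ ξ hξ).trans ((le_abs_self ρ).trans (by simp [hr]))
  have hbound : ∀ h : ℂ, r * ‖h‖ ≤ 1 → ‖fourierBorel μ (z + h) - fourierBorel μ z - h • D‖ ≤
      Real.exp (‖z‖ * r) * r ^ 2 * μ.variation.real univ * ‖h ^ 2‖ := by
    intro h hh
    have e1 : fourierBorel μ (z + h) - fourierBorel μ z - h • D =
        cintegral μ fun ξ => Complex.exp (-((z + h) * ξ)) - Complex.exp (-(z * ξ)) -
          h * (-ξ * Complex.exp (-(z * ξ))) := by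
      have e2 : cintegral μ (fun ξ => h * (-ξ * Complex.exp (-(z * ξ)))) = h • D :=
        cintegral_comp (ContinuousLinearMap.mul ℂ ℂ h) hint
      have i2 : μ.Integrable fun ξ : ℂ => h * (-ξ * Complex.exp (-(z * ξ))) :=
        integrable_of_continuousOn μ hK hμ (by fun_prop)
      rw [cintegral_sub ((integrable_exp hK hμ _).fun_sub (integrable_exp hK hμ _)) i2,
        cintegral_sub (integrable_exp hK hμ _) (integrable_exp hK hμ _), e2]
      rfl
    rw [e1]
    refine (norm_cintegral_le hμ (C := Real.exp (‖z‖ * r) * (r ^ 2 * ‖h ^ 2‖)) (by positivity)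
      fun ξ hξ => ?_).trans (by apply le_of_eq; ring)
    have e3 : Complex.exp (-((z + h) * ξ)) - Complex.exp (-(z * ξ)) -
        h * (-ξ * Complex.exp (-(z * ξ))) =
        Complex.exp (-(z * ξ)) * (Complex.exp (-(h * ξ)) - 1 - (-(h * ξ))) := by
      rw [add_mul, neg_add, Complex.exp_add]; ring
    have e4 : ‖-(h * ξ)‖ ≤ r * ‖h‖ := by
      rw [norm_neg, norm_mul, mul_comm]
      exact mul_le_mul_of_nonneg_right (hKr ξ hξ) (norm_nonneg _)
    rw [e3, norm_mul]
    refine mul_le_mul ?_ ?_ (norm_nonneg _) (Real.exp_pos _).le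
    · rw [Complex.norm_exp]
      refine Real.exp_le_exp.2 ((Complex.re_le_norm _).trans ?_)
      rw [norm_neg, norm_mul]
      exact mul_le_mul_of_nonneg_left (hKr ξ hξ) (norm_nonneg _)
    · refine (Complex.norm_exp_sub_one_sub_id_le (e4.trans hh)).trans ?_
      rw [norm_pow, ← mul_pow]
      exact pow_le_pow_left₀ (norm_nonneg _) e4 2
  have hder : HasDerivAt (fourierBorel μ) D z := by
    rw [hasDerivAt_iff_isLittleO_nhds_zero]
    refine Asymptotics.IsBigO.trans_isLittleO (g := fun h : ℂ => h ^ 2) ?_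
      (Asymptotics.isLittleO_pow_id one_lt_two)
    refine Asymptotics.IsBigO.of_bound
      (Real.exp (‖z‖ * r) * r ^ 2 * μ.variation.real univ) ?_
    have : ∀ᶠ h : ℂ in 𝓝 0, r * ‖h‖ < 1 := by
      have : Continuous fun h : ℂ => r * ‖h‖ := by fun_prop
      exact this.continuousAt.eventually_lt continuousAt_const (by simp)
    filter_upwards [this] with h hh using hbound h hh.le
  exact hder.differentiableAt

end FourierBorel

/-! ### Geometry of sectors. -/

section Sector

variable {α β : ℝ}

theorem arg_eq_arctan_of_re_pos {z : ℂ} (hz : 0 < z.re) : z.arg = Real.arctan (z.im / z.re) := by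
  have h := Complex.abs_arg_lt_pi_div_two_iff.2 (Or.inl hz)
  rw [← Complex.tan_arg, Real.arctan_tan (abs_lt.1 h).1 (abs_lt.1 h).2]

theorem abs_arctan (x : ℝ) : |Real.arctan x| = Real.arctan |x| := by
  rcases le_total 0 x with h | h
  · rw [abs_of_nonneg h, abs_of_nonneg (Real.arctan_nonneg.2 h)]
  · rw [abs_of_nonpos h, Real.arctan_neg, abs_of_nonpos]
    have := Real.arctan_mono h
    simpa using this

/-- Trading the argument for a linear inequality makes openness, convexity and additivity of the
sector immediate. -/
theorem mem_openSector_iff (h0 : 0 < α) (h1 : α < Real.pi / 2) {z : ℂ} :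
    z ∈ openSector α ↔ |z.im| < Real.tan α * z.re := by
  have ht := Real.tan_pos_of_pos_of_lt_pi_div_two h0 h1
  have key : ∀ x : ℝ, Real.arctan x < α ↔ x < Real.tan α := fun x => by
    conv_lhs => rw [← Real.arctan_tan (by linarith : -(Real.pi / 2) < α) h1]
    exact Real.arctan_strictMono.lt_iff_lt
  constructor
  · rintro ⟨hre, harg⟩
    rw [arg_eq_arctan_of_re_pos hre, abs_arctan, key, abs_div, abs_of_pos hre, div_lt_iff₀ hre]
      at harg
    exact harg
  · intro h
    have hre : 0 < z.re := pos_of_mul_pos_right ((abs_nonneg _).trans_lt h) ht.le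
    refine ⟨hre, ?_⟩
    rwa [arg_eq_arctan_of_re_pos hre, abs_arctan, key, abs_div, abs_of_pos hre, div_lt_iff₀ hre]

theorem abs_im_le_of_mem_closedSector (h0 : 0 < β) (h1 : β < Real.pi / 2) {z : ℂ}
    (hz : z ∈ closedSector β) : |z.im| ≤ Real.tan β * z.re := by
  obtain ⟨hre, harg⟩ := hz
  rw [arg_eq_arctan_of_re_pos hre, abs_arctan,
    ← Real.arctan_tan (by linarith : -(Real.pi / 2) < β) h1, Real.arctan_le_arctan_iff, abs_div,
    abs_of_pos hre, div_le_iff₀ hre] at harg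
  exact harg

theorem isOpen_openSector (h0 : 0 < α) (h1 : α < Real.pi / 2) : IsOpen (openSector α) := by
  have : openSector α = {z : ℂ | |z.im| < Real.tan α * z.re} :=
    Set.ext fun z => mem_openSector_iff h0 h1
  rw [this]
  exact isOpen_lt (by fun_prop) (by fun_prop)

theorem add_mem_openSector (h0 : 0 < α) (h1 : α < Real.pi / 2) {z w : ℂ} (hz : z ∈ openSector α)
    (hw : w ∈ openSector α) : z + w ∈ openSector α := by
  rw [mem_openSector_iff h0 h1] at *
  rw [Complex.add_im, Complex.add_re, mul_add]
  exact (abs_add_le _ _).trans_lt (add_lt_add hz hw)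

theorem ofReal_mul_mem_openSector (h0 : 0 < α) (h1 : α < Real.pi / 2) {z : ℂ}
    (hz : z ∈ openSector α) {r : ℝ} (hr : 0 < r) : (r : ℂ) * z ∈ openSector α := by
  rw [mem_openSector_iff h0 h1] at *
  rw [Complex.im_ofReal_mul, Complex.re_ofReal_mul, abs_mul, abs_of_pos hr]
  nlinarith

theorem convex_openSector (h0 : 0 < α) (h1 : α < Real.pi / 2) : Convex ℝ (openSector α) := by
  refine convex_iff_forall_pos.2 fun x hx y hy a b ha hb _ => ?_
  rw [Complex.real_smul, Complex.real_smul]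
  exact add_mem_openSector h0 h1 (ofReal_mul_mem_openSector h0 h1 hx ha)
    (ofReal_mul_mem_openSector h0 h1 hy hb)

theorem ofReal_mem_openSector (h0 : 0 < α) {r : ℝ} (hr : 0 < r) :
    (r : ℂ) ∈ openSector α :=
  ⟨by simpa using hr, by simpa [Complex.arg_ofReal_of_nonneg hr.le] using h0⟩

theorem nhdsWithin_openSector_neBot (h0 : 0 < α) : (𝓝[openSector α] (0 : ℂ)).NeBot := by
  rw [← mem_closure_iff_nhdsWithin_neBot]
  refine mem_closure_of_tendsto (f := fun r : ℝ => (r : ℂ)) (b := 𝓝[>] (0 : ℝ)) ?_ ?_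
  · have : ContinuousAt (fun r : ℝ => (r : ℂ)) 0 := by fun_prop
    simpa [ContinuousAt] using this.tendsto.mono_left nhdsWithin_le_nhds
  · filter_upwards [self_mem_nhdsWithin] with r hr using ofReal_mem_openSector h0 hr

theorem ne_zero_of_mem_openSector {z : ℂ} (hz : z ∈ openSector α) : z ≠ 0 := by
  rintro rfl
  simpa using hz.1

theorem mul_mem_openSector (hα : α < Real.pi / 2) {u v : ℂ} (hu : u ∈ openSector (α - β))
    (hv : v ∈ closedSector β) : u * v ∈ openSector α := by
  have hu0 := ne_zero_of_mem_openSector hu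
  have hv0 : v ≠ 0 := by rintro rfl; simpa using hv.1
  have hsum : |u.arg + v.arg| < α :=
    (abs_add_le _ _).trans_lt (by have := hu.2; have := hv.2; linarith)
  have h2 : |u.arg + v.arg| < Real.pi / 2 := hsum.trans hα
  have harg : (u * v).arg = u.arg + v.arg := by
    refine Complex.arg_mul hu0 hv0 ⟨?_, ?_⟩ <;>
    · have := abs_lt.1 h2; have := Real.pi_pos; linarith
  have h3 : |(u * v).arg| < Real.pi / 2 := by rwa [harg]
  refine ⟨?_, by rwa [harg]⟩
  exact (Complex.abs_arg_lt_pi_div_two_iff.1 h3).resolve_right (mul_ne_zero hu0 hv0)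

theorem conj_mem_closedSector {z : ℂ} (hz : z ∈ closedSector β) :
    starRingEnd ℂ z ∈ closedSector β :=
  ⟨by simpa using hz.1, by
    rw [Complex.arg_conj]
    split_ifs with h
    · exact h ▸ hz.2
    · rw [abs_neg]; exact hz.2⟩

theorem ofReal_mul_exp_mem_closedSector (h1 : β < Real.pi / 2) {θ : ℝ} (hθ : |θ| ≤ β)
    {N : ℝ} (hN : 0 < N) : (N : ℂ) * Complex.exp (θ * Complex.I) ∈ closedSector β := by
  have hθ' := abs_lt.1 (hθ.trans_lt h1)
  refine ⟨?_, ?_⟩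
  · rw [Complex.re_ofReal_mul, Complex.exp_ofReal_mul_I_re]
    exact mul_pos hN (Real.cos_pos_of_mem_Ioo hθ')
  · rw [Complex.arg_real_mul _ hN, Complex.exp_mul_I, Complex.arg_cos_add_sin_mul_I]
    · exact hθ
    · constructor <;> linarith [Real.pi_pos]

theorem re_nonneg_of_halfPlane (h0 : 0 < β) (h1 : β < Real.pi / 2) {z : ℂ}
    (hz' : 0 ≤ (z * Complex.exp (β * Complex.I)).re) : Real.tan β * z.im ≤ z.re := by
  have hc : 0 < Real.cos β := Real.cos_pos_of_mem_Ioo ⟨by linarith, h1⟩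
  rw [Complex.mul_re, Complex.exp_ofReal_mul_I_re, Complex.exp_ofReal_mul_I_im] at hz'
  rw [Real.tan_eq_sin_div_cos, div_mul_eq_mul_div, div_le_iff₀ hc]
  linarith

/-- Here `z` has argument in `[0, π/2 - β]` (or is `0`) and `ξ` has argument at most `β` in modulus.
This is where `|exp (-z ξ)| ≤ 1`, so it is where `H` is bounded. -/
theorem re_mul_nonneg_of_mem_closedSector (h0 : 0 < β) (h1 : β < Real.pi / 2) {z ξ : ℂ}
    (hz : 0 ≤ z.im) (hz' : 0 ≤ (z * Complex.exp (β * Complex.I)).re) (hξ : ξ ∈ closedSector β) :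
    0 ≤ (z * ξ).re := by
  have h2 := re_nonneg_of_halfPlane h0 h1 hz'
  have h3 := abs_im_le_of_mem_closedSector h0 h1 hξ
  have h4 := (abs_le.1 h3).2
  rw [Complex.mul_re]
  have := mul_le_mul_of_nonneg_right h2 hξ.1.le
  have := mul_le_mul_of_nonneg_left h4 hz
  nlinarith

end Sector

/-! ### Primitives on a sector, normalized at the vertex. -/

section Primitive

variable {α : ℝ} {E : Type*} [NormedAddCommGroup E] [NormedSpace ℂ E]

/-- Stands in for the integral of `g` from the vertex `0`, where `g` need not extend continuously.
Boundedness of `g` near `0` suffices: any primitive is Lipschitz on bounded parts of the sector, so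
it has a limit at `0`, which is subtracted. -/
theorem exists_primitive_openSector [CompleteSpace E] (h0 : 0 < α) (h1 : α < Real.pi / 2) {g : ℂ → E} {M κ : ℝ}
    (hκ : 0 ≤ κ) (hg : DifferentiableOn ℂ g (openSector α))
    (hM : ∀ s ∈ openSector α, ‖g s‖ ≤ M * Real.exp (κ * ‖s‖)) :
    ∃ Φ : ℂ → E, (∀ s ∈ openSector α, HasDerivAt Φ (g s) s) ∧
      Tendsto Φ (𝓝[openSector α] 0) (𝓝 0) ∧
      ∀ s ∈ openSector α, ‖Φ s‖ ≤ M * Real.exp (κ * ‖s‖) * ‖s‖ := by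
  have hconv := convex_openSector h0 h1
  have hopen := isOpen_openSector h0 h1
  have hM0 : 0 ≤ M := by
    have := (norm_nonneg _).trans (hM 1 (by simpa using ofReal_mem_openSector h0 one_pos))
    exact nonneg_of_mul_nonneg_left this (Real.exp_pos _)
  obtain ⟨P, hP⟩ := hconv.exists_forall_hasDerivWithinAt hg
  have hlip : ∀ r : ℝ, ∀ s ∈ openSector α ∩ Metric.closedBall 0 r,
      ∀ t ∈ openSector α ∩ Metric.closedBall 0 r,
      ‖P s - P t‖ ≤ M * Real.exp (κ * r) * ‖s - t‖ := by
    intro r s hs t ht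
    refine (hconv.inter (convex_closedBall 0 r)).norm_image_sub_le_of_norm_hasDerivWithin_le
      (f' := g) (fun x hx => (hP x hx.1).mono inter_subset_left) (fun x hx => ?_) ht hs
    refine (hM x hx.1).trans ?_
    have : ‖x‖ ≤ r := by simpa using hx.2
    gcongr
  have hne := nhdsWithin_openSector_neBot h0
  obtain ⟨L, hL⟩ : ∃ L, Tendsto P (𝓝[openSector α] 0) (𝓝 L) := by
    have hc : Cauchy (map P (𝓝[openSector α] 0)) := by
      have hu : UniformContinuousOn P (openSector α ∩ Metric.closedBall 0 1) :=
        (LipschitzOnWith.of_dist_le_mul (K := (M * Real.exp (κ * 1)).toNNReal)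
          fun s hs t ht => by
            rw [dist_eq_norm, dist_eq_norm, Real.coe_toNNReal _ (by positivity)]
            exact hlip 1 s hs t ht).uniformContinuousOn
      refine Cauchy.map_of_le (cauchy_nhds.mono nhdsWithin_le_nhds) hu ?_
      rw [le_principal_iff]
      exact inter_mem self_mem_nhdsWithin
        (nhdsWithin_le_nhds (Metric.closedBall_mem_nhds 0 one_pos))
    exact CompleteSpace.complete hc
  refine ⟨fun s => P s - L, fun s hs => ?_, ?_, fun s hs => ?_⟩
  · exact ((hP s hs).hasDerivAt (hopen.mem_nhds hs)).sub_const L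
  · simpa using hL.sub_const L
  · have hlim : Tendsto (fun t => ‖P s - P t‖) (𝓝[openSector α] 0) (𝓝 ‖P s - L‖) :=
      (tendsto_const_nhds.sub hL).norm
    have hlim2 : Tendsto (fun t => M * Real.exp (κ * ‖s‖) * ‖s - t‖) (𝓝[openSector α] 0)
        (𝓝 (M * Real.exp (κ * ‖s‖) * ‖s - 0‖)) := by
      refine Tendsto.mono_left ?_ nhdsWithin_le_nhds
      have : Continuous fun t : ℂ => M * Real.exp (κ * ‖s‖) * ‖s - t‖ := by fun_prop
      exact this.continuousAt.tendsto
    rw [sub_zero] at hlim2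
    refine le_of_tendsto_of_tendsto hlim hlim2 ?_
    have hs0 : 0 < ‖s‖ := norm_pos_iff.2 (ne_zero_of_mem_openSector hs)
    filter_upwards [self_mem_nhdsWithin,
      nhdsWithin_le_nhds (Metric.closedBall_mem_nhds (0 : ℂ) hs0)] with t ht ht'
    exact hlip ‖s‖ s ⟨hs, by simp⟩ t ⟨ht, ht'⟩

theorem eqOn_zero_of_hasDerivAt_zero (h0 : 0 < α) (h1 : α < Real.pi / 2) {D : ℂ → E}
    (hD : ∀ s ∈ openSector α, HasDerivAt D 0 s) (hlim : Tendsto D (𝓝[openSector α] 0) (𝓝 0)) :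
    ∀ s ∈ openSector α, D s = 0 := by
  intro s hs
  have := nhdsWithin_openSector_neBot h0
  have hc : ∀ t ∈ openSector α, D s = D t := fun t ht => by
    have := (convex_openSector h0 h1).norm_image_sub_le_of_norm_hasDerivWithin_le (f' := fun _ => 0)
      (C := 0) (fun x hx => (hD x hx).hasDerivWithinAt) (fun x _ => by simp) ht hs
    simpa [sub_eq_zero] using this
  refine tendsto_nhds_unique (tendsto_const_nhds.congr' ?_) hlim
  filter_upwards [self_mem_nhdsWithin] with t ht using hc t ht

end Primitive

/-! ### The inverse of the generator and the entire resolvent. -/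

section Resolvent

variable {α : ℝ} {𝔸 : Type*} [NormedRing 𝔸] [NormedAlgebra ℂ 𝔸]

/-- As functions of `t`, all the expressions have derivative `g (s + t)` and tend to `0` at the
vertex. -/
theorem semigroup_mul_primitive (h0 : 0 < α) (h1 : α < Real.pi / 2) {g Φ : ℂ → 𝔸}
    (hadd : ∀ s ∈ openSector α, ∀ t ∈ openSector α, g (s + t) = g s * g t)
    (hΦ : ∀ s ∈ openSector α, HasDerivAt Φ (g s) s)
    (hΦ0 : Tendsto Φ (𝓝[openSector α] 0) (𝓝 0)) {s t : ℂ} (hs : s ∈ openSector α)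
    (ht : t ∈ openSector α) :
    g s * Φ t = Φ (s + t) - Φ s ∧ Φ t * g s = Φ (s + t) - Φ s := by
  have hshift : ∀ x ∈ openSector α, HasDerivAt (fun x => Φ (s + x)) (g (s + x)) x := fun x hx => by
    simpa using (hΦ _ (add_mem_openSector h0 h1 hs hx)).comp_const_add s x
  have hl : Tendsto (fun x => Φ (s + x) - Φ s) (𝓝[openSector α] 0) (𝓝 0) := by
    have h2 : Tendsto (fun x : ℂ => s + x) (𝓝 0) (𝓝 s) := by
      simpa using (continuous_const_add s).tendsto (0 : ℂ)
    simpa using (((hΦ s hs).continuousAt.tendsto.comp h2).mono_left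
      nhdsWithin_le_nhds).sub_const (Φ s)
  constructor
  · have := eqOn_zero_of_hasDerivAt_zero h0 h1
      (D := fun x => g s * Φ x - (Φ (s + x) - Φ s)) (fun x hx => ?_) ?_ t ht
    · exact sub_eq_zero.1 this
    · simpa [hadd s hs x hx] using ((hΦ x hx).const_mul (g s)).fun_sub ((hshift x hx).sub_const (Φ s))
    · simpa using (hΦ0.const_mul (g s)).sub hl
  · have := eqOn_zero_of_hasDerivAt_zero h0 h1
      (D := fun x => Φ x * g s - (Φ (s + x) - Φ s)) (fun x hx => ?_) ?_ t ht
    · exact sub_eq_zero.1 this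
    · simpa [add_comm s x, hadd x hx s hs] using
        ((hΦ x hx).mul_const (g s)).fun_sub ((hshift x hx).sub_const (Φ s))
    · simpa using (hΦ0.mul_const (g s)).sub hl

/-- A semigroup with primitive `Φ` for which `1 - g w` is invertible for some `w` has an
inverse generator `R`, characterized by `g s * R = R - Φ s`. -/
theorem exists_inverse_generator (h0 : 0 < α) (h1 : α < Real.pi / 2) {g Φ : ℂ → 𝔸}
    (hadd : ∀ s ∈ openSector α, ∀ t ∈ openSector α, g (s + t) = g s * g t)
    (hΦ : ∀ s ∈ openSector α, HasDerivAt Φ (g s) s)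
    (hΦ0 : Tendsto Φ (𝓝[openSector α] 0) (𝓝 0)) {w : ℂ} (hw : w ∈ openSector α)
    (hunit : IsUnit (1 - g w)) :
    ∃ R : 𝔸, ∀ s ∈ openSector α, R * g s = R - Φ s ∧ g s * R = R - Φ s := by
  obtain ⟨U, hU⟩ := hunit
  have hcomm : ∀ s ∈ openSector α, g s * g w = g w * g s := fun s hs => by
    rw [← hadd s hs w hw, ← hadd w hw s hs, add_comm]
  have hcommU : ∀ s ∈ openSector α, g s * (↑U⁻¹ : 𝔸) = ↑U⁻¹ * g s := fun s hs => by
    have : Commute (g s) (U : 𝔸) := by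
      rw [hU]
      exact (Commute.one_right _).sub_right (hcomm s hs)
    exact this.units_inv_right
  -- Summing `g w ^ n * Φ w`, the integrals over successive steps of length `w`, suggests `(1 - g
  -- w)⁻¹ * Φ w` for the integral over `(0, ∞)`.
  refine ⟨↑U⁻¹ * Φ w, fun s hs => ?_⟩
  have hsw := semigroup_mul_primitive h0 h1 hadd hΦ hΦ0 hs hw
  have hws := semigroup_mul_primitive h0 h1 hadd hΦ hΦ0 hw hs
  have key : Φ w - (Φ (s + w) - Φ s) = U * Φ s := by
    rw [hU, sub_mul, one_mul, hws.1, add_comm w s]; abel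
  have key2 : (↑U⁻¹ : 𝔸) * (Φ (s + w) - Φ s) = ↑U⁻¹ * Φ w - Φ s := by
    have : Φ (s + w) - Φ s = Φ w - U * Φ s := by rw [← key]; abel
    rw [this, mul_sub, Units.inv_mul_cancel_left]
  constructor
  · rw [mul_assoc, hsw.2, key2]
  · rw [← mul_assoc, hcommU s hs, mul_assoc, hsw.1, key2]

/-- The resolvent `R z = (A - z)⁻¹` of a bounded analytic semigroup `T` of quasinilpotent elements
with generator `-A` is entire; `Φ z s` is the integral of `exp (z t) • T t` from `0` to `s`. -/
theorem exists_entire_resolvent [CompleteSpace 𝔸] (h0 : 0 < α) (h1 : α < Real.pi / 2) {T : ℂ → 𝔸}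
    {M : ℝ} (hT : DifferentiableOn ℂ T (openSector α))
    (hadd : ∀ s ∈ openSector α, ∀ t ∈ openSector α, T (s + t) = T s * T t)
    (hM : ∀ s ∈ openSector α, ‖T s‖ ≤ M)
    (hq : ∀ s ∈ openSector α, spectralRadius ℂ (T s) = 0) :
    ∃ (R : ℂ → 𝔸) (Φ : ℂ → ℂ → 𝔸), Differentiable ℂ R ∧
      (∀ z, ∀ s ∈ openSector α, HasDerivAt (Φ z) (Complex.exp (z * s) • T s) s) ∧
      (∀ z, ∀ s ∈ openSector α, ‖Φ z s‖ ≤ M * Real.exp (‖z‖ * ‖s‖) * ‖s‖) ∧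
      (∀ z, ∀ s ∈ openSector α, R z * (Complex.exp (z * s) • T s) = R z - Φ z s ∧
        (Complex.exp (z * s) • T s) * R z = R z - Φ z s) := by
  have hopen := isOpen_openSector h0 h1
  have h1S : (1 : ℂ) ∈ openSector α := by simpa using ofReal_mem_openSector h0 one_pos
  have hM0 : 0 ≤ M := (norm_nonneg _).trans (hM 1 h1S)
  have hprim : ∀ z : ℂ, ∃ Φ : ℂ → 𝔸,
      (∀ s ∈ openSector α, HasDerivAt Φ (Complex.exp (z * s) • T s) s) ∧
      Tendsto Φ (𝓝[openSector α] 0) (𝓝 0) ∧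
      ∀ s ∈ openSector α, ‖Φ s‖ ≤ M * Real.exp (‖z‖ * ‖s‖) * ‖s‖ := fun z => by
    refine exists_primitive_openSector h0 h1 (norm_nonneg z) (DifferentiableOn.fun_smul
      (by fun_prop) hT) fun s hs => ?_
    rw [norm_smul, mul_comm, Complex.norm_exp]
    refine mul_le_mul (hM s hs) (Real.exp_le_exp.2 ?_) (Real.exp_pos _).le hM0
    exact (Complex.re_le_norm _).trans (norm_mul_le _ _)
  choose Φ hΦ hΦ0 hΦn using hprim
  have hres : ∀ z : ℂ, ∃ R : 𝔸, ∀ s ∈ openSector α,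
      R * (Complex.exp (z * s) • T s) = R - Φ z s ∧
        (Complex.exp (z * s) • T s) * R = R - Φ z s := fun z => by
    refine exists_inverse_generator h0 h1 (fun s hs t ht => ?_) (hΦ z) (hΦ0 z) h1S ?_
    · rw [mul_add, Complex.exp_add, hadd s hs t ht, smul_mul_smul_comm]
    -- Quasinilpotence enters here: `1 - exp z • T 1 = exp z • (exp (-z) - T 1)` is invertible for
    -- every `z`.
    · have hmem : Complex.exp (-z) ∈ resolventSet ℂ (T 1) := by
        refine spectrum.mem_resolventSet_of_spectralRadius_lt ?_
        rw [hq 1 h1S]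
        simp [Complex.exp_ne_zero]
      rw [spectrum.mem_resolventSet_iff] at hmem
      have h2 := (IsUnit.mk0 _ (Complex.exp_ne_zero z)).map (algebraMap ℂ 𝔸) |>.mul hmem
      convert h2 using 1
      rw [mul_sub, ← map_mul, ← Complex.exp_add, add_neg_cancel, Complex.exp_zero, map_one,
        mul_one, Algebra.smul_def]
  choose R hR using hres
  have hne := nhdsWithin_openSector_neBot h0
  have hderiv : ∀ z, ∀ s ∈ openSector α, HasDerivAt (fun s => Complex.exp (z * s) • T s)
      (Complex.exp (z * s) • (z • T s + deriv T s)) s := fun z s hs => by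
    have h2 : HasDerivAt (fun s : ℂ => Complex.exp (z * s)) (Complex.exp (z * s) * z) s := by
      simpa using ((hasDerivAt_id s).const_mul z).cexp
    have h3 := (hT.differentiableAt (hopen.mem_nhds hs)).hasDerivAt
    have h4 := h2.fun_smul h3
    rwa [mul_smul, ← smul_add, add_comm] at h4
  -- Differentiating the defining identity of `R z` in `s` gives `R z * (A - z) = 1` and its mirror
  -- image, tested against `T s`, since `deriv T s = -A T s`.
  have hgen : ∀ z, ∀ s ∈ openSector α, R z * (z • T s + deriv T s) = -T s ∧
      (z • T s + deriv T s) * R z = -T s := fun z s hs => by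
    have hs' := hopen.mem_nhds hs
    have he := Complex.exp_ne_zero (z * s)
    constructor
    · have h2 := (hderiv z s hs).const_mul (R z)
      have h3 := ((hΦ z s hs).const_sub (R z)).congr_of_eventuallyEq
        (f₁ := fun s => R z * (Complex.exp (z * s) • T s))
        (by filter_upwards [hs'] with t ht using (hR z t ht).1)
      have h4 := h2.unique h3
      rw [mul_smul_comm, ← smul_neg] at h4
      exact smul_right_injective _ he h4
    · have h2 := (hderiv z s hs).mul_const (R z)
      have h3 := ((hΦ z s hs).const_sub (R z)).congr_of_eventuallyEq
        (f₁ := fun s => (Complex.exp (z * s) • T s) * R z)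
        (by filter_upwards [hs'] with t ht using (hR z t ht).2)
      have h4 := h2.unique h3
      rw [smul_mul_assoc, ← smul_neg] at h4
      exact smul_right_injective _ he h4
  set B := R 0 with hB
  have hBT : ∀ s ∈ openSector α, B * T s = B - Φ 0 s ∧ T s * B = B - Φ 0 s := fun s hs => by
    simpa using hR 0 s hs
  have hBT' : ∀ s ∈ openSector α, B * deriv T s = - T s ∧ deriv T s * B = - T s :=
    fun s hs => by simpa using hgen 0 s hs
  have hRT : ∀ z, ∀ s ∈ openSector α,
      R z * T s = Complex.exp (-(z * s)) • (R z - Φ z s) ∧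
      T s * R z = Complex.exp (-(z * s)) • (R z - Φ z s) := fun z s hs => by
    have he : Complex.exp (-(z * s)) * Complex.exp (z * s) = 1 := by
      rw [← Complex.exp_add, neg_add_cancel, Complex.exp_zero]
    constructor
    · rw [← (hR z s hs).1, mul_smul_comm, smul_smul, he, one_smul]
    · rw [← (hR z s hs).2, smul_mul_assoc, smul_smul, he, one_smul]
  have hexp0 : ∀ z : ℂ, Tendsto (fun s : ℂ => Complex.exp (-(z * s))) (𝓝[openSector α] 0) (𝓝 1) :=
    fun z => by
      have : Continuous fun s : ℂ => Complex.exp (-(z * s)) := by fun_prop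
      simpa using (this.tendsto 0).mono_left nhdsWithin_le_nhds
  have hlimB : Tendsto (fun s => B - Φ 0 s) (𝓝[openSector α] 0) (𝓝 B) := by
    simpa using (hΦ0 0).const_sub B
  have hlimR : ∀ z, Tendsto (fun s => Complex.exp (-(z * s)) • (R z - Φ z s))
      (𝓝[openSector α] 0) (𝓝 (R z)) := fun z => by
    simpa using (hexp0 z).smul ((hΦ0 z).const_sub (R z))
  -- The resolvent identity between `z` and `0`. It is first obtained with a factor `T s`, then `s →
  -- 0`: although `T s` itself need not converge in norm, its products with `R z` and `B` do.
  have hid1 : ∀ z, z • (R z * B) - R z + B = 0 := fun z => by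
    have hl : Tendsto (fun s => z • (R z * (B - Φ 0 s)) -
        Complex.exp (-(z * s)) • (R z - Φ z s) + (B - Φ 0 s)) (𝓝[openSector α] 0)
        (𝓝 (z • (R z * B) - R z + B)) :=
      (((hlimB.const_mul (R z)).const_smul z).sub (hlimR z)).add hlimB
    refine tendsto_nhds_unique hl (tendsto_const_nhds.congr' ?_)
    filter_upwards [self_mem_nhdsWithin] with s hs
    have h2 := congrArg (· * B) (hgen z s hs).1
    simp only [mul_add, add_mul, mul_smul_comm, smul_mul_assoc, mul_assoc, neg_mul,
      (hBT' s hs).2, mul_neg, (hBT s hs).2] at h2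
    rw [(hRT z s hs).1] at h2
    rw [sub_eq_add_neg, h2, neg_add_cancel]
  have hid2 : ∀ z, z • (B * R z) - R z + B = 0 := fun z => by
    have hl : Tendsto (fun s => z • ((B - Φ 0 s) * R z) -
        Complex.exp (-(z * s)) • (R z - Φ z s) + (B - Φ 0 s)) (𝓝[openSector α] 0)
        (𝓝 (z • (B * R z) - R z + B)) :=
      (((hlimB.mul_const (R z)).const_smul z).sub (hlimR z)).add hlimB
    refine tendsto_nhds_unique hl (tendsto_const_nhds.congr' ?_)
    filter_upwards [self_mem_nhdsWithin] with s hs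
    have h2 := congrArg (B * ·) (hgen z s hs).2
    simp only [mul_add, add_mul, mul_smul_comm, smul_mul_assoc, ← mul_assoc, neg_mul,
      (hBT' s hs).1, mul_neg, (hBT s hs).1] at h2
    rw [(hRT z s hs).2] at h2
    rw [sub_eq_add_neg, h2, neg_add_cancel]
  refine ⟨R, Φ, ?_, hΦ, hΦn, hR⟩
  have hinv1 : ∀ z, (1 + z • R z) * (1 - z • B) = 1 := fun z => by
    have := congrArg (z • ·) (hid1 z)
    simp only [smul_add, smul_sub, smul_zero] at this
    rw [add_mul, one_mul, mul_sub, mul_one, smul_mul_smul_comm, mul_smul]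
    rw [← sub_eq_zero, ← neg_eq_zero, ← this]; abel
  have hinv2 : ∀ z, (1 - z • B) * (1 + z • R z) = 1 := fun z => by
    have := congrArg (z • ·) (hid2 z)
    simp only [smul_add, smul_sub, smul_zero] at this
    rw [sub_mul, one_mul, mul_add, mul_one, smul_mul_smul_comm, mul_smul]
    rw [← sub_eq_zero, ← neg_eq_zero, ← this]; abel
  -- The resolvent identities make `1 - z • B` invertible for every `z`, so this formula exhibits
  -- `R` as entire.
  have hReq : R = fun z => B * Ring.inverse (1 - z • B) := by
    funext z
    have h2 : Ring.inverse (1 - z • B) = 1 + z • R z :=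
      Ring.inverse_unit (⟨1 - z • B, 1 + z • R z, hinv2 z, hinv1 z⟩ : 𝔸ˣ)
    rw [h2, mul_add, mul_one, mul_smul_comm]
    rw [← sub_eq_zero, ← neg_eq_zero, ← hid2 z]; abel
  rw [hReq]
  intro z
  have h2 : DifferentiableAt ℂ (Ring.inverse : 𝔸 → 𝔸) (1 - z • B) :=
    differentiableAt_inverse (⟨1 - z • B, 1 + z • R z, hinv2 z, hinv1 z⟩ : 𝔸ˣ).isUnit
  have h3 : DifferentiableAt ℂ (fun z : ℂ => 1 - z • B) z := by fun_prop
  exact (h2.comp z h3).const_mul B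

end Resolvent

/-! ### Estimates for the rescaled resolvent `R (z / u)`. -/

section Estimates

variable {α β M ρ : ℝ} {X : Type*} [NormedAddCommGroup X] [NormedSpace ℂ X]
  {T : ℂ → X →L[ℂ] X} {R : ℂ → X →L[ℂ] X} {Φ : ℂ → ℂ → X →L[ℂ] X} {μ : ComplexMeasure ℂ} {K : Set ℂ}

theorem norm_funcCalc_le (hα : α < Real.pi / 2) (hM0 : 0 ≤ M)
    (hM : ∀ s ∈ openSector α, ‖T s‖ ≤ M) (hKβ : K ⊆ closedSector β) (hμ : μ.variation Kᶜ = 0)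
    {u : ℂ} (hu : u ∈ openSector (α - β)) : ‖funcCalc T μ u‖ ≤ M * μ.variation.real univ :=
  norm_cintegral_le hμ hM0 fun _ hξ => hM _ (mul_mem_openSector hα hu (hKβ hξ))

/-- Under the integral, `R (z / u) * T (u ξ)` differs from `exp (-z ξ) • R (z / u)` only by a
multiple of `Φ (z / u) (u ξ)`. The scales cancel in the exponent `(z / u)(u ξ) = z ξ`, and the
length `|u ξ|` of the integration path supplies the factor `‖u‖`. -/
theorem norm_resolvent_mul_funcCalc_sub_le [CompleteSpace X] (hα : α < Real.pi / 2)
    (hT : DifferentiableOn ℂ T (openSector α)) (hM0 : 0 ≤ M)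
    (hΦ : ∀ z, ∀ s ∈ openSector α, ‖Φ z s‖ ≤ M * Real.exp (‖z‖ * ‖s‖) * ‖s‖)
    (hR : ∀ z, ∀ s ∈ openSector α, R z * (Complex.exp (z * s) • T s) = R z - Φ z s)
    (hK : IsCompact K) (hKβ : K ⊆ closedSector β) (hρ : ∀ ξ ∈ K, ‖ξ‖ ≤ ρ) (hρ0 : 0 ≤ ρ)
    (hμ : μ.variation Kᶜ = 0) {u : ℂ} (hu : u ∈ openSector (α - β)) (z : ℂ) :
    ‖R (z / u) * funcCalc T μ u - fourierBorel μ z • R (z / u)‖ ≤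
      Real.exp (‖z‖ * ρ) * (M * Real.exp (‖z‖ * ρ) * ρ) * μ.variation.real univ * ‖u‖ := by
  have hu0 := ne_zero_of_mem_openSector hu
  have hmaps : MapsTo (fun ξ => u * ξ) K (openSector α) :=
    fun ξ hξ => mul_mem_openSector hα hu (hKβ hξ)
  have hint : μ.Integrable fun ξ => T (u * ξ) :=
    integrable_of_continuousOn μ hK hμ (hT.continuousOn.comp (by fun_prop) hmaps)
  have e1 : cintegral μ (fun ξ => R (z / u) * T (u * ξ)) = R (z / u) * funcCalc T μ u :=
    cintegral_comp (ContinuousLinearMap.mul ℂ (X →L[ℂ] X) (R (z / u))) hint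
  have e2 : cintegral μ (fun ξ => Complex.exp (-(z * ξ)) • R (z / u)) =
      fourierBorel μ z • R (z / u) :=
    cintegral_comp (ContinuousLinearMap.toSpanSingleton ℂ (R (z / u))) (integrable_exp hK hμ z)
  have i1 : μ.Integrable fun ξ => R (z / u) * T (u * ξ) :=
    (ContinuousLinearMap.mul ℂ (X →L[ℂ] X) (R (z / u))).integrable_comp hint
  have i2 : μ.Integrable fun ξ => Complex.exp (-(z * ξ)) • R (z / u) :=
    (ContinuousLinearMap.toSpanSingleton ℂ (R (z / u))).integrable_comp (integrable_exp hK hμ z)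
  rw [← e1, ← e2, ← cintegral_sub i1 i2]
  refine (norm_cintegral_le hμ (C := Real.exp (‖z‖ * ρ) * (M * Real.exp (‖z‖ * ρ) * (‖u‖ * ρ)))
    (by positivity) fun ξ hξ => ?_).trans (by apply le_of_eq; ring)
  have hz : z / u * (u * ξ) = z * ξ := by field_simp
  have hzn : ‖z / u‖ * ‖u * ξ‖ = ‖z‖ * ‖ξ‖ := by rw [← norm_mul, hz, norm_mul]
  have hle : ‖z‖ * ‖ξ‖ ≤ ‖z‖ * ρ := mul_le_mul_of_nonneg_left (hρ ξ hξ) (norm_nonneg _)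
  have e3 : R (z / u) * T (u * ξ) - Complex.exp (-(z * ξ)) • R (z / u) =
      -(Complex.exp (-(z * ξ)) • Φ (z / u) (u * ξ)) := by
    have h2 := hR (z / u) _ (hmaps hξ)
    have h3 : R (z / u) * T (u * ξ) = Complex.exp (-(z * ξ)) • (R (z / u) - Φ (z / u) (u * ξ)) := by
      rw [← h2, hz, mul_smul_comm, smul_smul, ← Complex.exp_add, neg_add_cancel, Complex.exp_zero,
        one_smul]
    rw [h3, smul_sub]; abel
  rw [e3, norm_neg, norm_smul]
  refine mul_le_mul ?_ ?_ (norm_nonneg _) (Real.exp_pos _).le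
  · rw [Complex.norm_exp]
    refine Real.exp_le_exp.2 ((Complex.re_le_norm _).trans ?_)
    rw [norm_neg, norm_mul]
    exact hle
  · refine (hΦ _ _ (hmaps hξ)).trans ?_
    rw [hzn, norm_mul]
    have := hρ ξ hξ
    gcongr

/-- Two applications of the approximate eigenvalue relation replace the operators for `μ` and `ν` by
their scalar transforms. If the operator product has norm below `c`, this bounds `R (z / u)`
wherever the scalar product exceeds `c` in modulus. -/
theorem norm_resolvent_mul_sub_le [CompleteSpace X] (hα : α < Real.pi / 2)
    (hT : DifferentiableOn ℂ T (openSector α)) (hM0 : 0 ≤ M)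
    (hM : ∀ s ∈ openSector α, ‖T s‖ ≤ M)
    (hΦ : ∀ z, ∀ s ∈ openSector α, ‖Φ z s‖ ≤ M * Real.exp (‖z‖ * ‖s‖) * ‖s‖)
    (hR : ∀ z, ∀ s ∈ openSector α, R z * (Complex.exp (z * s) • T s) = R z - Φ z s)
    (hK : IsCompact K) (hKβ : K ⊆ closedSector β) (hρ : ∀ ξ ∈ K, ‖ξ‖ ≤ ρ) (hρ0 : 0 ≤ ρ)
    (hμ : μ.variation Kᶜ = 0) {K' : Set ℂ} {ν : ComplexMeasure ℂ}
    (hK' : IsCompact K') (hKβ' : K' ⊆ closedSector β) (hρ' : ∀ ξ ∈ K', ‖ξ‖ ≤ ρ)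
    (hν : ν.variation K'ᶜ = 0) :
    ∃ C : ℝ → ℝ, Continuous C ∧ (∀ r, 0 ≤ C r) ∧ ∀ u ∈ openSector (α - β), ∀ z,
      ‖R (z / u)‖ * (‖fourierBorel μ z * fourierBorel ν z‖ - ‖funcCalc T μ u * funcCalc T ν u‖) ≤
        C ‖z‖ * ‖u‖ := by
  set m := μ.variation.real univ
  set n := ν.variation.real univ
  have hm : 0 ≤ m := measureReal_nonneg
  have hn : 0 ≤ n := measureReal_nonneg
  set D : ℝ → ℝ := fun r => Real.exp (r * ρ) * (M * Real.exp (r * ρ) * ρ) with hD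
  refine ⟨fun r => D r * m * (M * n) + Real.exp (r * ρ) * m * (D r * n), by fun_prop,
    fun r => by positivity, fun u hu z => ?_⟩
  have h1 := norm_resolvent_mul_funcCalc_sub_le hα hT hM0 hΦ hR hK hKβ hρ hρ0 hμ hu z
  have h2 := norm_resolvent_mul_funcCalc_sub_le hα hT hM0 hΦ hR hK' hKβ' hρ' hρ0 hν hu z
  have h3 := norm_funcCalc_le hα hM0 hM hKβ' hν hu
  have h4 : ‖fourierBorel μ z‖ ≤ Real.exp (‖z‖ * ρ) * m := by
    have := norm_fourierBorel_le hμ (z := z) (δ := -(‖z‖ * ρ)) fun ξ hξ => by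
      have h5 := (abs_le.1 (Complex.abs_re_le_norm (z * ξ))).1
      rw [norm_mul] at h5
      have h6 := mul_le_mul_of_nonneg_left (hρ ξ hξ) (norm_nonneg z)
      linarith
    simpa using this
  set A := R (z / u)
  set P := funcCalc T μ u
  set Q := funcCalc T ν u
  have e : (fourierBorel μ z * fourierBorel ν z) • A = A * (P * Q) -
      ((A * P - fourierBorel μ z • A) * Q + fourierBorel μ z • (A * Q - fourierBorel ν z • A)) := by
    rw [sub_mul, smul_sub, smul_mul_assoc, smul_smul, mul_assoc]; abel
  have h5 : ‖fourierBorel μ z * fourierBorel ν z‖ * ‖A‖ ≤ ‖A‖ * ‖P * Q‖ +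
      ((D ‖z‖ * m * ‖u‖) * (M * n) + Real.exp (‖z‖ * ρ) * m * (D ‖z‖ * n * ‖u‖)) := by
    rw [← norm_smul, e]
    refine (norm_sub_le _ _).trans (add_le_add (norm_mul_le _ _) ((norm_add_le _ _).trans
      (add_le_add ?_ ?_)))
    · exact (norm_mul_le _ _).trans (mul_le_mul h1 h3 (norm_nonneg _) (by positivity))
    · rw [norm_smul]
      exact mul_le_mul h4 h2 (norm_nonneg _) (by positivity)
  linarith

/-- With `exp (z v) • T (u v)` of norm at most `1/2`, the relation `R = R * (exp (z v) • T (u v)) +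
Φ` lets half of `‖R‖` be absorbed on the left. -/
theorem norm_resolvent_le_of_norm_semigroup_le (hα : α < Real.pi / 2)
    (hM : ∀ s ∈ openSector α, ‖T s‖ ≤ M)
    (hΦ : ∀ z, ∀ s ∈ openSector α, ‖Φ z s‖ ≤ M * Real.exp (‖z‖ * ‖s‖) * ‖s‖)
    (hR : ∀ z, ∀ s ∈ openSector α, R z * (Complex.exp (z * s) • T s) = R z - Φ z s)
    {u v z : ℂ} (hu : u ∈ openSector (α - β)) (hv : v ∈ closedSector β)
    (hz : Real.exp (z * v).re * M ≤ 1 / 2) :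
    ‖R (z / u)‖ ≤ 2 * M * Real.exp (‖z‖ * ‖v‖) * ‖v‖ * ‖u‖ := by
  have hu0 := ne_zero_of_mem_openSector hu
  have huv := mul_mem_openSector hα hu hv
  have hzv : z / u * (u * v) = z * v := by field_simp
  have h1 := hR (z / u) _ huv
  have h2 := hΦ (z / u) _ huv
  rw [← norm_mul (z / u), hzv, norm_mul, norm_mul] at h2
  rw [hzv] at h1
  have h3 : ‖Complex.exp (z * v) • T (u * v)‖ ≤ 1 / 2 := by
    rw [norm_smul, Complex.norm_exp]
    exact (mul_le_mul_of_nonneg_left (hM _ huv) (Real.exp_pos _).le).trans hz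
  have h4 : ‖R (z / u)‖ ≤ ‖R (z / u)‖ * (1 / 2) + ‖Φ (z / u) (u * v)‖ := by
    have : R (z / u) = R (z / u) * (Complex.exp (z * v) • T (u * v)) + Φ (z / u) (u * v) := by
      rw [h1]; abel
    conv_lhs => rw [this]
    refine (norm_add_le _ _).trans (add_le_add_left ((norm_mul_le _ _).trans ?_) _)
    exact mul_le_mul_of_nonneg_left h3 (norm_nonneg _)
  linarith

/-- Uniform bound of the rescaled resolvents on the half planes `Re (z * exp (θ I)) < 0`. -/
theorem eventually_norm_resolvent_le_of_halfPlane (hα : α < Real.pi / 2) (hβα : β < α)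
    (hM0 : 0 ≤ M) (hM : ∀ s ∈ openSector α, ‖T s‖ ≤ M)
    (hΦ : ∀ z, ∀ s ∈ openSector α, ‖Φ z s‖ ≤ M * Real.exp (‖z‖ * ‖s‖) * ‖s‖)
    (hR : ∀ z, ∀ s ∈ openSector α, R z * (Complex.exp (z * s) • T s) = R z - Φ z s)
    {θ : ℝ} (hθ : |θ| ≤ β) {z₀ : ℂ} (hz₀ : (z₀ * Complex.exp (θ * Complex.I)).re < 0) :
    ∃ C, ∀ᶠ z in 𝓝 z₀, ∀ u ∈ openSector (α - β), ‖R (z / u)‖ ≤ C * ‖u‖ := by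
  set a := (z₀ * Complex.exp (θ * Complex.I)).re with ha
  obtain ⟨N, hN0, hN⟩ : ∃ N : ℝ, 0 < N ∧ Real.exp (a * N) * M < 1 / 2 := by
    have h1 : Tendsto (fun N : ℝ => Real.exp (a * N) * M) atTop (𝓝 (0 * M)) :=
      (Real.tendsto_exp_atBot.comp
        ((tendsto_const_mul_atBot_of_neg hz₀).2 tendsto_id)).mul_const M
    rw [zero_mul] at h1
    exact ((eventually_gt_atTop 0).and (h1.eventually_lt_const (by norm_num))).exists
  set v : ℂ := (N : ℂ) * Complex.exp (θ * Complex.I) with hv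
  have hvm : v ∈ closedSector β := ofReal_mul_exp_mem_closedSector (hβα.trans hα) hθ hN0
  have hzv : Real.exp (z₀ * v).re * M < 1 / 2 := by
    have : z₀ * v = (N : ℂ) * (z₀ * Complex.exp (θ * Complex.I)) := by rw [hv]; ring
    rw [this, Complex.re_ofReal_mul, mul_comm N]
    exact hN
  refine ⟨2 * M * Real.exp ((‖z₀‖ + 1) * ‖v‖) * ‖v‖, ?_⟩
  have hc1 : ∀ᶠ z in 𝓝 z₀, Real.exp (z * v).re * M < 1 / 2 := by
    have : Continuous fun z : ℂ => Real.exp (z * v).re * M := by fun_prop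
    exact this.continuousAt.eventually_lt continuousAt_const hzv
  have hc2 : ∀ᶠ z in 𝓝 z₀, ‖z‖ < ‖z₀‖ + 1 :=
    continuous_norm.continuousAt.eventually_lt continuousAt_const (by simp)
  filter_upwards [hc1, hc2] with z hz1 hz2 u hu
  refine (norm_resolvent_le_of_norm_semigroup_le hα hM hΦ hR hu hvm hz1.le).trans ?_
  gcongr

end Estimates

/-! ### Superlevel sets of `|H|` and Phragmén–Lindelöf. -/

section LevelSets

variable {β c : ℝ} {H : ℂ → ℂ}

/-- The part of `{‖H‖ > c}` in the upper half plane. -/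
def upperSuperlevel (H : ℂ → ℂ) (c : ℝ) : Set ℂ := {z | 0 < z.im ∧ c < ‖H z‖}

theorem isOpen_upperSuperlevel (hH : Continuous H) : IsOpen (upperSuperlevel H c) :=
  (isOpen_lt continuous_const Complex.continuous_im).inter (isOpen_lt continuous_const hH.norm)

/-- A frontier point with `|H| > c` off the real axis would lie in the superlevel set, hence in the
open component itself. On the real axis the half-plane condition forces it to be nonnegative, where
`|H| ≤ c`. -/
theorem norm_le_of_mem_frontier_component (h0 : 0 < β) (h1 : β < Real.pi / 2) (hH : Continuous H)
    (hreal : ∀ x : ℝ, 0 ≤ x → ‖H x‖ ≤ c) {p : ℂ}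
    (hhalf : ∀ z ∈ connectedComponentIn (upperSuperlevel H c) p,
      0 ≤ (z * Complex.exp (β * Complex.I)).re) {z : ℂ}
    (hz : z ∈ frontier (connectedComponentIn (upperSuperlevel H c) p)) : ‖H z‖ ≤ c := by
  set S := upperSuperlevel H c
  have hS : IsOpen S := isOpen_upperSuperlevel hH
  by_contra! hcz
  have hcl : z ∈ closure (connectedComponentIn S p) := frontier_subset_closure hz
  have him : 0 ≤ z.im := by
    have : closure (connectedComponentIn S p) ⊆ {z : ℂ | 0 ≤ z.im} :=
      closure_minimal (fun w hw => (connectedComponentIn_subset S p hw).1.le)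
        (isClosed_le continuous_const Complex.continuous_im)
    exact this hcl
  have hre : 0 ≤ (z * Complex.exp (β * Complex.I)).re := by
    have : closure (connectedComponentIn S p) ⊆
        {z : ℂ | 0 ≤ (z * Complex.exp (β * Complex.I)).re} :=
      closure_minimal hhalf (isClosed_le continuous_const (by fun_prop))
    exact this hcl
  rcases him.eq_or_lt with h | h
  · have h2 := re_nonneg_of_halfPlane h0 h1 hre
    rw [← h, mul_zero] at h2
    have hzx : z = (z.re : ℂ) := Complex.ext (by simp) (by simp [← h])
    rw [hzx] at hcz
    exact absurd (hreal _ h2) (not_le.2 hcz)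
  · have hzS : z ∈ S := ⟨h, hcz⟩
    have hV : connectedComponentIn S z ∈ 𝓝 z :=
      hS.connectedComponentIn.mem_nhds (mem_connectedComponentIn hzS)
    obtain ⟨w, hwV, hwU⟩ := mem_closure_iff_nhds.1 hcl _ hV
    have heq : connectedComponentIn S z = connectedComponentIn S p :=
      (connectedComponentIn_eq hwV).trans (connectedComponentIn_eq hwU).symm
    have hzU : z ∈ connectedComponentIn S p := heq ▸ mem_connectedComponentIn hzS
    rw [hS.connectedComponentIn.frontier_eq] at hz
    exact hz.2 hzU

/-- A Phragmén–Lindelöf argument: each component of `{Im z > 0, ‖H z‖ > c}` leaves the sector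
in which `H` is bounded. -/
theorem exists_mem_component_halfPlane (h0 : 0 < β) (h1 : β < Real.pi / 2)
    (hH : Differentiable ℂ H) (hc : 0 < c) (hreal : ∀ x : ℝ, 0 ≤ x → ‖H x‖ ≤ c) {B : ℝ}
    (hB : ∀ z : ℂ, 0 ≤ z.im → 0 ≤ (z * Complex.exp (β * Complex.I)).re → ‖H z‖ ≤ B) {p : ℂ}
    (hp : p ∈ upperSuperlevel H c) :
    ∃ z ∈ connectedComponentIn (upperSuperlevel H c) p,
      (z * Complex.exp (β * Complex.I)).re < 0 := by
  by_contra! hhalf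
  set S := upperSuperlevel H c
  set U := connectedComponentIn S p with hU
  have hS : IsOpen S := isOpen_upperSuperlevel hH.continuous
  have hpU : p ∈ U := mem_connectedComponentIn hp
  have hclB : ∀ z ∈ closure U, ‖H z‖ ≤ B := fun z hz => by
    refine closure_minimal (t := {z | ‖H z‖ ≤ B}) (fun w hw => ?_)
      (isClosed_le hH.continuous.norm continuous_const) hz
    exact hB w (connectedComponentIn_subset S p hw).1.le (hhalf w hw)
  have hclre : ∀ z ∈ closure U, 0 ≤ z.re := fun z hz => by
    refine closure_minimal (t := {z : ℂ | 0 ≤ z.re}) (fun w hw => ?_)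
      (isClosed_le continuous_const Complex.continuous_re) hz
    show 0 ≤ w.re
    refine le_trans (mul_nonneg ?_ (connectedComponentIn_subset S p hw).1.le)
      (re_nonneg_of_halfPlane h0 h1 (hhalf w hw))
    exact (Real.tan_pos_of_pos_of_lt_pi_div_two h0 h1).le
  have hone : ∀ z ∈ closure U, 1 ≤ ‖1 + z‖ := fun z hz => by
    refine le_trans ?_ ((le_abs_self _).trans (Complex.abs_re_le_norm _))
    have := hclre z hz
    simpa using this
  have hB0 : 0 ≤ B := (norm_nonneg _).trans (hclB p (subset_closure hpU))
  -- Maximum principle for `H ^ n / (1 + z)` on the component cut off by a large disc. The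
  -- denominator beats the bound `B ^ n` on the circle, and taking `n`-th roots removes its effect
  -- at `p`.
  have hpow : ∀ n : ℕ, ‖H p‖ ^ n ≤ c ^ n * ‖1 + p‖ := by
    intro n
    set r : ℝ := max (‖p‖ + 1) (B ^ n / c ^ n + 1) with hr
    have hpr : p ∈ U ∩ Metric.ball 0 r :=
      ⟨hpU, by
        rw [mem_ball_zero_iff]
        exact (lt_add_one _).trans_le (le_max_left _ _)⟩
    have hdc : DiffContOnCl ℂ (fun z => H z ^ n / (1 + z)) (U ∩ Metric.ball 0 r) := by
      refine DifferentiableOn.diffContOnCl fun z hz => ?_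
      have hz' : (1 : ℂ) + z ≠ 0 := norm_pos_iff.1
        (one_pos.trans_le (hone z (closure_mono inter_subset_left hz)))
      exact (((hH z).pow n).div (by fun_prop) hz').differentiableWithinAt
    have hle := Complex.norm_le_of_forall_mem_frontier_norm_le
      (Metric.isBounded_ball.subset inter_subset_right) hdc (C := c ^ n) (fun z hz => ?_)
      (subset_closure hpr)
    · rw [norm_div, norm_pow, div_le_iff₀ (one_pos.trans_le (hone p (subset_closure hpU)))] at hle
      exact hle
    · rw [norm_div, norm_pow]
      rcases frontier_inter_subset _ _ hz with ⟨hz1, -⟩ | ⟨hz1, hz2⟩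
      · have h2 := hone z (frontier_subset_closure hz1)
        have h3 := norm_le_of_mem_frontier_component h0 h1 hH.continuous hreal hhalf hz1
        rw [div_le_iff₀ (one_pos.trans_le h2)]
        exact (pow_le_pow_left₀ (norm_nonneg _) h3 n).trans
          (le_mul_of_one_le_right (by positivity) h2)
      · have h2 := hone z hz1
        rw [div_le_iff₀ (one_pos.trans_le h2)]
        refine (pow_le_pow_left₀ (norm_nonneg _) (hclB z hz1) n).trans ?_
        have h3 : ‖z‖ = r := by simpa using Metric.frontier_ball_subset_sphere hz2
        have h4 : B ^ n / c ^ n + 1 ≤ ‖z‖ := h3 ▸ le_max_right _ _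
        have h5 : ‖z‖ ≤ ‖1 + z‖ + 1 := by
          have := norm_sub_le (1 + z) 1
          simpa using this
        have h6 : B ^ n / c ^ n ≤ ‖1 + z‖ := by linarith
        rw [div_le_iff₀ (by positivity)] at h6
        linarith
  have hlt : 1 < ‖H p‖ / c := (one_lt_div hc).2 hp.2
  obtain ⟨n, hn⟩ := ((tendsto_pow_atTop_atTop_of_one_lt hlt).eventually_gt_atTop ‖1 + p‖).exists
  rw [div_pow, lt_div_iff₀ (by positivity)] at hn
  linarith [hpow n]

/-- At a real point where a function that is real on the real line takes the value `c > 0`,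
the modulus grows at a polynomial rate along some ray into the upper half plane. -/
theorem exists_ray_norm_ge (hH : Differentiable ℂ H)
    (hconj : ∀ z, H (starRingEnd ℂ z) = starRingEnd ℂ (H z)) {x₀ : ℝ} (hx₀ : H x₀ = c)
    (hne : ∃ z, H z ≠ c) :
    ∃ (e : ℂ) (k : ℕ) (a s₀ : ℝ), 0 < e.im ∧ 0 < k ∧ 0 < a ∧ 0 < s₀ ∧
      ∀ s ∈ Ioc 0 s₀, c + a * s ^ k ≤ ‖H (x₀ + s * e)‖ := by
  set f : ℂ → ℂ := fun z => H z - c with hf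
  have hfd : Differentiable ℂ f := hH.sub_const _
  have hfa : AnalyticAt ℂ f x₀ := hfd.analyticAt x₀
  have hnz : ¬ ∀ᶠ z in 𝓝 (x₀ : ℂ), f z = 0 := by
    intro h
    obtain ⟨z, hz⟩ := hne
    have h2 := AnalyticOnNhd.eqOn_zero_of_preconnected_of_eventuallyEq_zero (U := univ)
      (fun z _ => hfd.analyticAt z) isPreconnected_univ (mem_univ _) h
    exact hz (sub_eq_zero.1 (h2 (mem_univ z)))
  obtain ⟨k, g, hg, hg0, hgf⟩ := hfa.exists_eventuallyEq_pow_smul_nonzero_iff.2 hnz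
  have hk : 0 < k := by
    refine Nat.pos_of_ne_zero fun hk => hg0 ?_
    have h2 := hgf.self_of_nhds
    simp only [hk, pow_zero, one_smul] at h2
    rw [← h2, hf]
    simp [hx₀]
  have hline : ∀ e : ℂ, Tendsto (fun s : ℝ => (x₀ : ℂ) + s * e) (𝓝 0) (𝓝 x₀) := fun e => by
    have : Continuous fun s : ℝ => (x₀ : ℂ) + s * e := by fun_prop
    simpa using this.tendsto 0
  -- In `H - c = (z - x₀) ^ k * g`, the left side is real on the real axis, so `g` is real there
  -- near `x₀`, at `x₀` itself by continuity.
  have hgim : (g x₀).im = 0 := by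
    have hl : Tendsto (fun s : ℝ => (g ((x₀ : ℂ) + s * 1)).im) (𝓝[≠] 0) (𝓝 (g x₀).im) :=
      ((Complex.continuous_im.tendsto _).comp
        (hg.continuousAt.tendsto.comp (hline 1))).mono_left nhdsWithin_le_nhds
    refine tendsto_nhds_unique hl (tendsto_const_nhds.congr' ?_)
    filter_upwards [self_mem_nhdsWithin, nhdsWithin_le_nhds ((hline 1).eventually hgf)] with s hs hs'
    have hr : (x₀ : ℂ) + s * 1 = ((x₀ + s : ℝ) : ℂ) := by push_cast; ring
    have h2 : (f ((x₀ + s : ℝ) : ℂ)).im = 0 := by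
      have := hconj ((x₀ + s : ℝ) : ℂ)
      rw [Complex.conj_ofReal] at this
      have h3 := Complex.conj_eq_iff_im.1 this.symm
      rw [hf, Complex.sub_im, h3, Complex.ofReal_im, sub_zero]
    rw [hr] at hs' ⊢
    have h4 : (((x₀ + s : ℝ) : ℂ) - x₀) ^ k = ((s ^ k : ℝ) : ℂ) := by push_cast; ring
    rw [hs', h4, smul_eq_mul, Complex.im_ofReal_mul] at h2
    exact ((mul_eq_zero.1 h2).resolve_left (pow_ne_zero _ hs)).symm
  obtain ⟨e, he, hek⟩ : ∃ e : ℂ, 0 < e.im ∧ 0 < (g x₀ * e ^ k).re := by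
    have hk1 : (1 : ℝ) ≤ k := by exact_mod_cast hk
    have hk0 : (k : ℂ) ≠ 0 := by exact_mod_cast hk.ne'
    -- The direction `exp (i φ / k)` turns `e ^ k` into `exp (i φ)`; `φ` in `(0, π)` keeps `e` in
    -- the upper half plane and still allows either sign of the cosine.
    have key : ∀ φ : ℝ, 0 < φ → φ < Real.pi → 0 < (g x₀).re * Real.cos φ →
        ∃ e : ℂ, 0 < e.im ∧ 0 < (g x₀ * e ^ k).re := by
      intro φ h1 h2 h3
      refine ⟨Complex.exp ((φ / k : ℝ) * Complex.I), ?_, ?_⟩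
      · rw [Complex.exp_ofReal_mul_I_im]
        exact Real.sin_pos_of_pos_of_lt_pi (by positivity)
          ((div_le_self h1.le hk1).trans_lt h2)
      · have : Complex.exp ((φ / k : ℝ) * Complex.I) ^ k = Complex.exp (φ * Complex.I) := by
          rw [← Complex.exp_nat_mul]
          congr 1
          push_cast
          field_simp
        rw [this, Complex.mul_re, hgim, zero_mul, sub_zero, Complex.exp_ofReal_mul_I_re]
        exact h3
    have hpi := Real.pi_pos
    have hre0 : (g x₀).re ≠ 0 := fun h => hg0 (Complex.ext h hgim)
    rcases hre0.lt_or_gt with h | h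
    · refine key (3 * Real.pi / 4) (by positivity) (by linarith) (mul_pos_of_neg_of_neg h ?_)
      exact Real.cos_neg_of_pi_div_two_lt_of_lt (by linarith) (by linarith)
    · refine key (Real.pi / 4) (by positivity) (by linarith) (mul_pos h ?_)
      exact Real.cos_pos_of_mem_Ioo ⟨by linarith, by linarith⟩
  set a := (g x₀ * e ^ k).re / 2 with ha
  have ha0 : 0 < a := half_pos hek
  have hev : ∀ᶠ s : ℝ in 𝓝 0, a < (g ((x₀ : ℂ) + s * e) * e ^ k).re := by
    have hl : Tendsto (fun s : ℝ => (g ((x₀ : ℂ) + s * e) * e ^ k).re) (𝓝 0)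
        (𝓝 (g x₀ * e ^ k).re) :=
      (Complex.continuous_re.tendsto _).comp
        ((hg.continuousAt.tendsto.comp (hline e)).mul_const _)
    exact hl.eventually_const_lt (half_lt_self hek)
  obtain ⟨ε, hε, hball⟩ := Metric.eventually_nhds_iff.1 (hev.and ((hline e).eventually hgf))
  refine ⟨e, k, a, ε / 2, he, hk, ha0, half_pos hε, fun s hs => ?_⟩
  obtain ⟨h1, h2⟩ := hball (y := s) (by
    rw [Real.dist_eq, sub_zero, abs_of_pos hs.1]; linarith [hs.2])
  have h3 : H (x₀ + s * e) = c + ((s ^ k : ℝ) : ℂ) * (g (x₀ + s * e) * e ^ k) := by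
    have : f (x₀ + s * e) = ((s ^ k : ℝ) : ℂ) * (g (x₀ + s * e) * e ^ k) := by
      rw [h2, smul_eq_mul, add_sub_cancel_left, mul_pow]
      push_cast
      ring
    rw [← this, hf]
    ring
  refine le_trans ?_ (Complex.re_le_norm _)
  rw [h3, Complex.add_re, Complex.ofReal_re, Complex.re_ofReal_mul, mul_comm a]
  have := mul_le_mul_of_nonneg_left h1.le (pow_nonneg hs.1.le k)
  linarith

end LevelSets

/-! ### Cauchy's formula through branches of the logarithm. -/

section Contour

variable {ι E : Type*} [NormedAddCommGroup E] [NormedSpace ℂ E]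

/-- A family of functions whose derivatives are locally bounded by multiples of weights `b i` on a
preconnected set has increments bounded by multiples of the `b i`. -/
theorem exists_norm_sub_le_of_isPreconnected {U : Set ℂ} (hU : IsPreconnected U)
    {P P' : ι → ℂ → E} {b : ι → ℝ}
    (h : ∀ z₀ ∈ U, ∃ C, ∀ᶠ z in 𝓝 z₀, ∀ i, HasDerivAt (P i) (P' i z) z ∧ ‖P' i z‖ ≤ C * b i)
    {x y : ℂ} (hx : x ∈ U) (hy : y ∈ U) : ∃ C, ∀ i, ‖P i x - P i y‖ ≤ C * b i := by
  refine hU.induction₂ (fun x y => ∃ C, ∀ i, ‖P i x - P i y‖ ≤ C * b i) (fun z₀ hz₀ => ?_) ?_ ?_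
    hx hy
  · obtain ⟨C, hC⟩ := h z₀ hz₀
    obtain ⟨ε, hε, hball⟩ := Metric.eventually_nhds_iff_ball.1 hC
    refine nhdsWithin_le_nhds ?_
    filter_upwards [Metric.ball_mem_nhds z₀ hε] with z hz
    refine ⟨C * ‖z₀ - z‖, fun i => ?_⟩
    have := (convex_ball z₀ ε).norm_image_sub_le_of_norm_hasDerivWithin_le (f := P i)
      (f' := P' i) (C := C * b i) (fun x hx => ((hball x hx) i).1.hasDerivWithinAt)
      (fun x hx => ((hball x hx) i).2) hz (Metric.mem_ball_self hε)
    linarith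
  · rintro x y z - - - ⟨C, hC⟩ ⟨D, hD⟩
    refine ⟨C + D, fun i => ?_⟩
    have := norm_sub_le_norm_sub_add_norm_sub (P i x) (P i y) (P i z)
    linarith [hC i, hD i]
  · rintro x y - - ⟨C, hC⟩
    exact ⟨C, fun i => by rw [norm_sub_rev]; exact hC i⟩

/-- Local uniform boundedness of a family of functions by multiples of weights. -/
def LocallyBoundedAt (f : ι → ℂ → E) (b : ι → ℝ) (z₀ : ℂ) : Prop :=
  ∃ C, ∀ᶠ z in 𝓝 z₀, ∀ i, ‖f i z‖ ≤ C * b i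

/-- `L • f 0 + G` is a primitive of `f z / z`, because `f z / z = f 0 / z + dslope f 0 z`. Its
increments play the role of contour integrals, so no path inside `U` has to be chosen. -/
theorem exists_norm_log_branch_sub_le {f : ι → ℂ → E} {b : ι → ℝ} {G : ι → ℂ → E}
    (hG : ∀ i z, HasDerivAt (G i) (dslope (f i) 0 z) z) {L : ℂ → ℂ} {U : Set ℂ}
    (hU : IsPreconnected U) (hL : ∀ z ∈ U, z ≠ 0 ∧ ∀ᶠ w in 𝓝 z, HasDerivAt L w⁻¹ w)
    (hf : ∀ z ∈ U, LocallyBoundedAt f b z) {x y : ℂ} (hx : x ∈ U) (hy : y ∈ U) :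
    ∃ C, ∀ i, ‖(L x • f i 0 + G i x) - (L y • f i 0 + G i y)‖ ≤ C * b i := by
  refine exists_norm_sub_le_of_isPreconnected (P := fun i z => L z • f i 0 + G i z)
    (P' := fun i z => z⁻¹ • f i z) hU (fun z₀ hz₀ => ?_) hx hy
  obtain ⟨C, hC⟩ := hf z₀ hz₀
  obtain ⟨h0, hL'⟩ := hL z₀ hz₀
  refine ⟨(‖z₀⁻¹‖ + 1) * C, ?_⟩
  have hinv : ∀ᶠ z in 𝓝 z₀, ‖z⁻¹‖ < ‖z₀⁻¹‖ + 1 :=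
    (continuousAt_inv₀ h0).norm.eventually_lt continuousAt_const (by simp)
  filter_upwards [hC, hL', hinv, eventually_ne_nhds h0] with z h1 h2 h3 h4 i
  constructor
  · have h5 : z⁻¹ • f i z = z⁻¹ • f i 0 + dslope (f i) 0 z := by
      rw [dslope_of_ne _ h4, slope_def_module, sub_zero, ← smul_add]; congr 1; abel
    rw [h5]
    exact (h2.smul_const (f i 0)).add (hG i z)
  · rw [norm_smul, mul_assoc]
    exact mul_le_mul h3.le (h1 i) (norm_nonneg _) (by positivity)

/-- At the real endpoint `x₀` a bound is available only along the ray, not in a neighbourhood, so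
this piece uses the actual segment. -/
theorem exists_norm_log_segment_sub_le {f : ι → ℂ → E} {b : ι → ℝ} {G : ι → ℂ → E}
    (hG : ∀ i z, HasDerivAt (G i) (dslope (f i) 0 z) z) {x₀ s₀ : ℝ} (hx₀ : 0 < x₀) (hs₀ : 0 < s₀)
    {e : ℂ} (he : e.im ≠ 0) (hf : ∃ C, ∀ s ∈ Icc 0 s₀, ∀ i, ‖f i (x₀ + s * e)‖ ≤ C * b i) :
    ∃ C, ∀ i, ‖(Complex.log (x₀ + s₀ * e) • f i 0 + G i (x₀ + s₀ * e)) -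
      (Complex.log x₀ • f i 0 + G i x₀)‖ ≤ C * b i := by
  obtain ⟨C, hC⟩ := hf
  have hslit : ∀ s ∈ Icc 0 s₀, (x₀ : ℂ) + s * e ∈ Complex.slitPlane := fun s hs => by
    rw [Complex.mem_slitPlane_iff]
    rcases eq_or_ne s 0 with rfl | h
    · left; simpa using hx₀
    · right; simpa using ⟨h, he⟩
  have hcont : ContinuousOn (fun s : ℝ => ((x₀ : ℂ) + s * e)⁻¹) (Icc 0 s₀) :=
    ContinuousOn.inv₀ (by fun_prop) fun s hs => Complex.slitPlane_ne_zero (hslit s hs)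
  obtain ⟨D, hD⟩ := isCompact_Icc.exists_bound_of_continuousOn hcont
  have hD0 : 0 ≤ D := (norm_nonneg _).trans (hD 0 ⟨le_rfl, hs₀.le⟩)
  refine ⟨‖e‖ * (D * C) * s₀, fun i => ?_⟩
  have key := (convex_Icc (0 : ℝ) s₀).norm_image_sub_le_of_norm_hasDerivWithin_le
    (f := fun s : ℝ => Complex.log (x₀ + s * e) • f i 0 + G i (x₀ + s * e))
    (f' := fun s : ℝ => e • (((x₀ : ℂ) + s * e)⁻¹ • f i (x₀ + s * e)))
    (C := ‖e‖ * (D * (C * b i))) (fun s hs => ?_) (fun s hs => ?_) (x := 0) (y := s₀)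
    ⟨le_rfl, hs₀.le⟩ ⟨hs₀.le, le_rfl⟩
  · simp only [Complex.ofReal_zero, zero_mul, add_zero, sub_zero, Real.norm_eq_abs,
      abs_of_pos hs₀] at key
    exact key.trans (by apply le_of_eq; ring)
  · have hz := hslit s hs
    have hz0 := Complex.slitPlane_ne_zero hz
    have h1 : HasDerivAt (fun z => Complex.log z • f i 0 + G i z)
        (((x₀ : ℂ) + s * e)⁻¹ • f i (x₀ + s * e)) (x₀ + s * e) := by
      have h5 : ((x₀ : ℂ) + s * e)⁻¹ • f i (x₀ + s * e) =
          ((x₀ : ℂ) + s * e)⁻¹ • f i 0 + dslope (f i) 0 (x₀ + s * e) := by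
        rw [dslope_of_ne _ hz0, slope_def_module, sub_zero, ← smul_add]; congr 1; abel
      rw [h5]
      exact ((Complex.hasDerivAt_log hz).smul_const (f i 0)).add (hG i _)
    have h2 : HasDerivAt (fun s : ℝ => (x₀ : ℂ) + s * e) e s := by
      simpa using ((hasDerivAt_id s).ofReal_comp.mul_const e).const_add (x₀ : ℂ)
    exact (h1.scomp s h2).hasDerivWithinAt
  · rw [norm_smul, norm_smul]
    exact mul_le_mul_of_nonneg_left
      (mul_le_mul (hD s hs) (hC s hs i) (norm_nonneg _) hD0) (norm_nonneg _)

/-- A Cauchy estimate at the origin along a contour symmetric about the real axis: from the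
positive real point `x₀` along a ray into a connected set `U` of the upper half plane, through `U`
and through two half planes containing the negative real axis. -/
theorem exists_norm_apply_zero_le [CompleteSpace E] {f : ι → ℂ → E} {b : ι → ℝ}
    (hf : ∀ i, Differentiable ℂ (f i)) {U : Set ℂ} (hU : IsPreconnected U)
    (hUim : ∀ z ∈ U, 0 < z.im) (hfU : ∀ z ∈ U, LocallyBoundedAt f b z)
    (hfU' : ∀ z ∈ U, LocallyBoundedAt f b (starRingEnd ℂ z))
    {β : ℝ} (hβ : 0 < Real.cos β)
    (hfp : ∀ z : ℂ, (z * Complex.exp (β * Complex.I)).re < 0 → LocallyBoundedAt f b z)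
    (hfm : ∀ z : ℂ, (z * Complex.exp ((-β : ℝ) * Complex.I)).re < 0 → LocallyBoundedAt f b z)
    {x₀ s₀ : ℝ} (hx₀ : 0 < x₀) (hs₀ : 0 < s₀) {e : ℂ} (he : e.im ≠ 0)
    (hseg : ∃ C, ∀ s ∈ Icc 0 s₀, ∀ i, ‖f i (x₀ + s * e)‖ ≤ C * b i)
    (hseg' : ∃ C, ∀ s ∈ Icc 0 s₀, ∀ i, ‖f i (x₀ + s * starRingEnd ℂ e)‖ ≤ C * b i)
    (hp : (x₀ : ℂ) + s₀ * e ∈ U) {z₁ : ℂ} (hz₁ : z₁ ∈ U)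
    (hz₁' : (z₁ * Complex.exp (β * Complex.I)).re < 0) :
    ∃ C, ∀ i, ‖f i 0‖ ≤ C * b i := by
  have hprim : ∀ i, ∃ G : ℂ → E, ∀ z, HasDerivAt G (dslope (f i) 0 z) z := fun i => by
    have hd : DifferentiableOn ℂ (dslope (f i) 0) univ :=
      (Complex.differentiableOn_dslope univ_mem).2 (hf i).differentiableOn
    obtain ⟨G, hG⟩ := convex_univ.exists_forall_hasDerivWithinAt hd
    exact ⟨G, fun z => (hG z (mem_univ z)).hasDerivAt univ_mem⟩
  choose G hG using hprim
  have hlog : ∀ z : ℂ, z.im ≠ 0 → z ≠ 0 ∧ ∀ᶠ w in 𝓝 z, HasDerivAt Complex.log w⁻¹ w :=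
    fun z hz => by
      have hs : z ∈ Complex.slitPlane := Or.inr hz
      refine ⟨Complex.slitPlane_ne_zero hs, ?_⟩
      filter_upwards [Complex.isOpen_slitPlane.mem_nhds hs] with w hw
        using Complex.hasDerivAt_log hw
  have hlog' : ∀ z : ℂ, -z ∈ Complex.slitPlane →
      z ≠ 0 ∧ ∀ᶠ w in 𝓝 z, HasDerivAt (fun w => Complex.log (-w)) w⁻¹ w := fun z hz => by
    refine ⟨neg_ne_zero.1 (Complex.slitPlane_ne_zero hz), ?_⟩
    filter_upwards [(Complex.isOpen_slitPlane.preimage continuous_neg).mem_nhds hz] with w hw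
    have := (Complex.hasDerivAt_log hw).comp w (hasDerivAt_neg w)
    simpa [Function.comp_def, inv_neg] using this
  have hhalf : ∀ θ : ℝ, IsPreconnected {z : ℂ | (z * Complex.exp (θ * Complex.I)).re < 0} :=
    fun θ => by
      refine (convex_halfSpace_lt (f := fun z : ℂ => (z * Complex.exp (θ * Complex.I)).re)
        ⟨fun x y => ?_, fun r x => ?_⟩ 0).isPreconnected
      · rw [add_mul, Complex.add_re]
      · rw [Complex.real_smul, mul_assoc, Complex.re_ofReal_mul, smul_eq_mul]
  have hslit : ∀ θ : ℝ, 0 < Real.cos θ → ∀ z : ℂ, (z * Complex.exp (θ * Complex.I)).re < 0 →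
      -z ∈ Complex.slitPlane := fun θ hθ z hz => by
    rw [Complex.mem_slitPlane_iff]
    by_contra! h
    rw [Complex.neg_re, Complex.neg_im] at h
    have him : z.im = 0 := neg_eq_zero.1 h.2
    rw [Complex.mul_re, Complex.exp_ofReal_mul_I_re, him, zero_mul, sub_zero] at hz
    nlinarith [h.1]
  have hcosm : 0 < Real.cos (-β) := by rwa [Real.cos_neg]
  have hm1 : ∀ θ : ℝ, 0 < Real.cos θ →
      (-1 : ℂ) ∈ {z : ℂ | (z * Complex.exp (θ * Complex.I)).re < 0} := fun θ hθ => by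
    rw [mem_ofPred_eq, neg_mul, one_mul, Complex.neg_re, Complex.exp_ofReal_mul_I_re]
    linarith
  have hz₁c : starRingEnd ℂ z₁ ∈
      {z : ℂ | (z * Complex.exp ((-β : ℝ) * Complex.I)).re < 0} := by
    have : starRingEnd ℂ z₁ * Complex.exp ((-β : ℝ) * Complex.I) =
        starRingEnd ℂ (z₁ * Complex.exp (β * Complex.I)) := by
      rw [map_mul, ← Complex.exp_conj, map_mul, Complex.conj_ofReal, Complex.conj_I]
      push_cast
      ring_nf
    rw [mem_ofPred_eq, this, Complex.conj_re]
    exact hz₁'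
  have hUc : IsPreconnected (starRingEnd ℂ '' U) :=
    hU.image _ Complex.continuous_conj.continuousOn
  have hpc : (x₀ : ℂ) + s₀ * starRingEnd ℂ e = starRingEnd ℂ (x₀ + s₀ * e) := by simp
  obtain ⟨C₁, h₁⟩ := exists_norm_log_segment_sub_le hG hx₀ hs₀ he hseg
  obtain ⟨C₂, h₂⟩ := exists_norm_log_segment_sub_le hG hx₀ hs₀
    (e := starRingEnd ℂ e) (by simpa using he) hseg'
  obtain ⟨C₃, h₃⟩ := exists_norm_log_branch_sub_le hG hU
    (fun z hz => hlog z (hUim z hz).ne') hfU hz₁ hp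
  obtain ⟨C₄, h₄⟩ := exists_norm_log_branch_sub_le (x := starRingEnd ℂ z₁)
    (y := x₀ + s₀ * starRingEnd ℂ e) hG hUc
    (by rintro _ ⟨z, hz, rfl⟩; exact hlog _ (by simpa using (hUim z hz).ne'))
    (by rintro _ ⟨z, hz, rfl⟩; exact hfU' z hz) (mem_image_of_mem _ hz₁)
    (by rw [hpc]; exact mem_image_of_mem _ hp)
  obtain ⟨C₅, h₅⟩ := exists_norm_log_branch_sub_le hG (hhalf β)
    (fun z hz => hlog' z (hslit β hβ z hz)) hfp hz₁' (hm1 β hβ)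
  obtain ⟨C₆, h₆⟩ := exists_norm_log_branch_sub_le hG (hhalf (-β))
    (fun z hz => hlog' z (hslit (-β) hcosm z hz)) hfm hz₁c (hm1 (-β) hcosm)
  have him := hUim z₁ hz₁
  -- The branch `log (-z)`, used across the negative axis, differs from `log z` by `πi` in opposite
  -- senses at `z₁` and at its conjugate. The two discrepancies add up to the winding term `2πi`.
  have hl1 : Complex.log (-z₁) = Complex.log z₁ - Real.pi * Complex.I := by
    rw [Complex.log, Complex.log, norm_neg, Complex.arg_neg_eq_arg_sub_pi_of_im_pos him]
    push_cast; ring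
  have hl2 : Complex.log (-starRingEnd ℂ z₁) =
      Complex.log (starRingEnd ℂ z₁) + Real.pi * Complex.I := by
    rw [Complex.log, Complex.log, norm_neg,
      Complex.arg_neg_eq_arg_add_pi_of_im_neg (by simpa using him)]
    push_cast; ring
  refine ⟨(C₁ + C₂ + C₃ + C₄ + C₅ + C₆) / (2 * Real.pi), fun i => ?_⟩
  have hpi := Real.pi_pos
  have hsum : ((2 * Real.pi : ℝ) * Complex.I) • f i 0 =
      ((Complex.log z₁ • f i 0 + G i z₁) -
        (Complex.log (x₀ + s₀ * e) • f i 0 + G i (x₀ + s₀ * e))) +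
      ((Complex.log (x₀ + s₀ * e) • f i 0 + G i (x₀ + s₀ * e)) -
        (Complex.log x₀ • f i 0 + G i x₀)) -
      ((Complex.log (starRingEnd ℂ z₁) • f i 0 + G i (starRingEnd ℂ z₁)) -
        (Complex.log (x₀ + s₀ * starRingEnd ℂ e) • f i 0 + G i (x₀ + s₀ * starRingEnd ℂ e))) -
      ((Complex.log (x₀ + s₀ * starRingEnd ℂ e) • f i 0 + G i (x₀ + s₀ * starRingEnd ℂ e)) -
        (Complex.log x₀ • f i 0 + G i x₀)) -
      ((Complex.log (-z₁) • f i 0 + G i z₁) - (Complex.log (-(-1)) • f i 0 + G i (-1))) +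
      ((Complex.log (-starRingEnd ℂ z₁) • f i 0 + G i (starRingEnd ℂ z₁)) -
        (Complex.log (-(-1)) • f i 0 + G i (-1))) := by
    rw [hl1, hl2]
    push_cast
    module
  have hn := congrArg norm hsum
  rw [norm_smul, norm_mul, Complex.norm_I, mul_one, Complex.norm_real, Real.norm_eq_abs,
    abs_of_pos (by positivity : (0 : ℝ) < 2 * Real.pi)] at hn
  rw [div_mul_eq_mul_div, le_div_iff₀ (by positivity), mul_comm ‖f i 0‖, hn]
  refine (norm_add_le _ _).trans ?_
  refine (add_le_add_left ((norm_sub_le _ _).trans (add_le_add_left ((norm_sub_le _ _).trans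
    (add_le_add_left ((norm_sub_le _ _).trans (add_le_add_left (norm_add_le _ _) _)) _)) _)) _).trans
    ?_
  linarith [h₁ i, h₂ i, h₃ i, h₄ i, h₅ i, h₆ i]

end Contour

/-! ### The bound on the resolvent at the origin. -/

section Rescaled

variable {E : Type*} [NormedAddCommGroup E] [NormedSpace ℂ E]

theorem LocallyBoundedAt.smul {ι : Type*} {f : ι → ℂ → E} {b : ι → ℝ} {z₀ : ℂ}
    (hf : LocallyBoundedAt f b z₀) {q : ℂ → ℂ} (hq : ContinuousAt q z₀) :
    LocallyBoundedAt (fun i z => q z • f i z) b z₀ := by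
  obtain ⟨C, hC⟩ := hf
  refine ⟨(‖q z₀‖ + 1) * C, ?_⟩
  have h1 : ∀ᶠ z in 𝓝 z₀, ‖q z‖ < ‖q z₀‖ + 1 :=
    hq.norm.eventually_lt continuousAt_const (by simp)
  filter_upwards [hC, h1] with z h2 h3 i
  rw [norm_smul, mul_assoc]
  exact mul_le_mul h3.le (h2 i) (norm_nonneg _) (by positivity)

/-- Cauchy's estimate for the family `z ↦ R (z / u)`, all of whose members take the value `R 0` at
the origin. -/
theorem exists_norm_entire_zero_le [CompleteSpace E] {β c B x₀ : ℝ} {H : ℂ → ℂ} (h0 : 0 < β)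
    (h1 : β < Real.pi / 2) (hH : Differentiable ℂ H)
    (hconj : ∀ z, H (starRingEnd ℂ z) = starRingEnd ℂ (H z)) (hc : 0 < c)
    (hreal : ∀ x : ℝ, 0 ≤ x → ‖H x‖ ≤ c)
    (hB : ∀ z : ℂ, 0 ≤ z.im → 0 ≤ (z * Complex.exp (β * Complex.I)).re → ‖H z‖ ≤ B)
    (hx₀ : 0 < x₀) (hHx₀ : H x₀ = c) (hne : ∃ z, H z ≠ c) {R : ℂ → E} (hR : Differentiable ℂ R)
    {C : ℝ → ℝ} (hC : Continuous C) {s : Set ℂ}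
    (hest : ∀ u ∈ s, ∀ z, ‖R (z / u)‖ * (‖H z‖ - c) ≤ C ‖z‖ * ‖u‖)
    (hhalf : ∀ θ : ℝ, |θ| ≤ β → ∀ z₀ : ℂ, (z₀ * Complex.exp (θ * Complex.I)).re < 0 →
      ∃ D, ∀ᶠ z in 𝓝 z₀, ∀ u ∈ s, ‖R (z / u)‖ ≤ D * ‖u‖) :
    ∃ D, ∀ u ∈ s, ‖R 0‖ ≤ D * ‖u‖ := by
  obtain ⟨e, k, a, s₀, he, hk, ha, hs₀, hray⟩ := exists_ray_norm_ge hH hconj hHx₀ hne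
  have hnorm : ∀ z, ‖H (starRingEnd ℂ z)‖ = ‖H z‖ := fun z => by rw [hconj, RCLike.norm_conj]
  set p : ℂ := x₀ + s₀ * e with hp
  have hpS : p ∈ upperSuperlevel H c := by
    refine ⟨by simpa [hp] using mul_pos hs₀ he, lt_of_lt_of_le ?_ (hray s₀ ⟨hs₀, le_rfl⟩)⟩
    have : 0 < a * s₀ ^ k := by positivity
    linarith
  obtain ⟨z₁, hz₁, hz₁'⟩ := exists_mem_component_halfPlane h0 h1 hH hc hreal hB hpS
  -- Along the ray `|H| - c ≥ a t ^ k`, so the bound on `R (z / u)` grows at most like `t ^ (-k)`;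
  -- this factor cancels it and has modulus `x₀ ^ k ≠ 0` at the origin.
  set q : ℂ → ℂ := fun z => (z - x₀) ^ k with hq
  have hqc : Continuous q := by fun_prop
  set g : s → ℂ → E := fun u z => R (z / u) with hg
  set b : s → ℝ := fun u => ‖(u : ℂ)‖ with hb
  have hloc : ∀ z, c < ‖H z‖ → LocallyBoundedAt g b z := fun z hz => by
    set d := (‖H z‖ - c) / 2 with hd
    have hd0 : 0 < d := half_pos (sub_pos.2 hz)
    refine ⟨(C ‖z‖ + 1) / d, ?_⟩
    have e1 : ∀ᶠ w in 𝓝 z, d < ‖H w‖ - c :=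
      continuousAt_const.eventually_lt (hH.continuous.norm.sub continuous_const).continuousAt
        (half_lt_self (sub_pos.2 hz))
    have e2 : ∀ᶠ w in 𝓝 z, C ‖w‖ < C ‖z‖ + 1 :=
      (hC.comp continuous_norm).continuousAt.eventually_lt continuousAt_const (by simp)
    filter_upwards [e1, e2] with w h2 h3 u
    rw [div_mul_eq_mul_div, le_div_iff₀ hd0]
    exact (mul_le_mul_of_nonneg_left h2.le (norm_nonneg _)).trans ((hest u u.2 w).trans
      (mul_le_mul_of_nonneg_right h3.le (norm_nonneg _)))
  have hlocp : ∀ θ : ℝ, |θ| ≤ β → ∀ z : ℂ, (z * Complex.exp (θ * Complex.I)).re < 0 →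
      LocallyBoundedAt g b z := fun θ hθ z hz => by
    obtain ⟨D, hD⟩ := hhalf θ hθ z hz
    exact ⟨D, hD.mono fun w hw u => hw u u.2⟩
  have hseg : ∀ e' : ℂ, (∀ t ∈ Ioc 0 s₀, c + a * t ^ k ≤ ‖H (x₀ + t * e')‖) →
      ∃ D, ∀ t ∈ Icc 0 s₀, ∀ u, ‖q (x₀ + t * e') • g u (x₀ + t * e')‖ ≤ D * b u := by
    intro e' he'
    have hcont : ContinuousOn (fun t : ℝ => C ‖(x₀ : ℂ) + t * e'‖) (Icc 0 s₀) :=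
      (hC.comp (by fun_prop)).continuousOn
    obtain ⟨D, hD⟩ := isCompact_Icc.exists_bound_of_continuousOn hcont
    have hD0 : 0 ≤ D := (norm_nonneg _).trans (hD 0 ⟨le_rfl, hs₀.le⟩)
    refine ⟨‖e'‖ ^ k * (D / a), fun t ht u => ?_⟩
    rcases ht.1.eq_or_lt with h | h
    · have : q (x₀ + t * e') = 0 := by simp [hq, ← h, hk.ne']
      rw [this, zero_smul, norm_zero]
      positivity
    · have h2 : ‖q (x₀ + t * e')‖ = t ^ k * ‖e'‖ ^ k := by
        rw [hq]
        simp only [add_sub_cancel_left, norm_pow, norm_mul, Complex.norm_real, Real.norm_eq_abs,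
          abs_of_pos h, mul_pow]
      have h3 : ‖g u (x₀ + t * e')‖ * (a * t ^ k) ≤ D * b u := by
        refine (mul_le_mul_of_nonneg_left ?_ (norm_nonneg _)).trans ((hest u u.2 _).trans
          (mul_le_mul_of_nonneg_right ((le_abs_self _).trans (hD t ht)) (norm_nonneg _)))
        linarith [he' t ⟨h, ht.2⟩]
      rw [norm_smul, h2]
      calc t ^ k * ‖e'‖ ^ k * ‖g u (x₀ + t * e')‖
          = ‖e'‖ ^ k * (‖g u (x₀ + t * e')‖ * (a * t ^ k) / a) := by field_simp
        _ ≤ ‖e'‖ ^ k * (D * b u / a) := by gcongr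
        _ = ‖e'‖ ^ k * (D / a) * b u := by ring
  have hray' : ∀ t ∈ Ioc 0 s₀, c + a * t ^ k ≤ ‖H (x₀ + t * starRingEnd ℂ e)‖ := fun t ht => by
    have : (x₀ : ℂ) + t * starRingEnd ℂ e = starRingEnd ℂ (x₀ + t * e) := by simp
    rw [this, hnorm]
    exact hray t ht
  have hsub := connectedComponentIn_subset (upperSuperlevel H c) p
  obtain ⟨D, hD⟩ := exists_norm_apply_zero_le (f := fun u z => q z • g u z) (b := b) (β := β)
    (U := connectedComponentIn (upperSuperlevel H c) p)
    (fun u => Differentiable.fun_smul (by fun_prop) (hR.comp (differentiable_id.div_const _)))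
    isPreconnected_connectedComponentIn (fun z hz => (hsub hz).1)
    (fun z hz => (hloc z (hsub hz).2).smul hqc.continuousAt)
    (fun z hz => (hloc _ ((hnorm z).symm ▸ (hsub hz).2)).smul hqc.continuousAt)
    (Real.cos_pos_of_mem_Ioo ⟨by linarith, h1⟩)
    (fun z hz => (hlocp β (abs_of_pos h0).le z hz).smul hqc.continuousAt)
    (fun z hz => (hlocp (-β) (by rw [abs_neg, abs_of_pos h0]) z hz).smul hqc.continuousAt)
    hx₀ hs₀ he.ne' (hseg e hray) (hseg _ hray') (mem_connectedComponentIn hpS) hz₁ hz₁'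
  refine ⟨D / x₀ ^ k, fun u hu => ?_⟩
  have h2 := hD ⟨u, hu⟩
  have h3 : ‖q 0‖ = x₀ ^ k := by
    rw [hq]
    simp [abs_of_pos hx₀]
  rw [norm_smul, h3, hg] at h2
  simp only [zero_div] at h2
  rw [div_mul_eq_mul_div, le_div_iff₀ (by positivity), mul_comm]
  exact h2

end Rescaled

/-! ### The maximum on the positive axis and the conclusion. -/

section Main

/-- Compactness keeps `Re ξ` away from `0` on `K`, so the transform decays at infinity; zero mass
makes it vanish at `0`. The maximum is therefore attained strictly inside the half line. -/
theorem exists_isMaxOn_norm_fourierBorel {μ : ComplexMeasure ℂ} {K : Set ℂ} (hK : IsCompact K)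
    (hKre : ∀ ξ ∈ K, 0 < ξ.re) (hμ : μ.variation Kᶜ = 0) (h0 : μ K = 0) {t₁ : ℝ} (ht₁ : 0 < t₁)
    (hne : fourierBorel μ t₁ ≠ 0) :
    ∃ x : ℝ, 0 < x ∧ ∀ t : ℝ, 0 ≤ t → ‖fourierBorel μ t‖ ≤ ‖fourierBorel μ x‖ := by
  set q : ℝ → ℝ := fun t => ‖fourierBorel μ t‖ with hq
  have hqc : Continuous q :=
    ((differentiable_fourierBorel hK hμ).continuous.comp Complex.continuous_ofReal).norm
  have hq1 : 0 < q t₁ := norm_pos_iff.2 hne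
  have hlim : Tendsto q atTop (𝓝 0) := by
    obtain ⟨δ, hδ, hKδ⟩ : ∃ δ : ℝ, 0 < δ ∧ ∀ ξ ∈ K, δ ≤ ξ.re := by
      rcases K.eq_empty_or_nonempty with rfl | hne
      · exact ⟨1, one_pos, by simp⟩
      · obtain ⟨ξ, hξ, hmin⟩ := hK.exists_isMinOn hne Complex.continuous_re.continuousOn
        exact ⟨ξ.re, hKre ξ hξ, fun y hy => hmin hy⟩
    have hl : Tendsto (fun t : ℝ => Real.exp (-(t * δ)) * μ.variation.real univ) atTop
        (𝓝 (0 * μ.variation.real univ)) :=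
      (Real.tendsto_exp_neg_atTop_nhds_zero.comp
        (tendsto_id.atTop_mul_const hδ)).mul_const _
    rw [zero_mul] at hl
    refine squeeze_zero' (Eventually.of_forall fun t => norm_nonneg _) ?_ hl
    filter_upwards [eventually_ge_atTop 0] with t ht
    refine norm_fourierBorel_le hμ fun ξ hξ => ?_
    rw [Complex.re_ofReal_mul]
    exact mul_le_mul_of_nonneg_left (hKδ ξ hξ) ht
  obtain ⟨A, hA⟩ := eventually_atTop.1 (hlim.eventually_lt_const hq1)
  have hA1 : t₁ < A := by
    by_contra! h
    exact lt_irrefl _ (hA t₁ h)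
  obtain ⟨x, hx, hmax⟩ := isCompact_Icc.exists_isMaxOn ⟨t₁, ht₁.le, hA1.le⟩ hqc.continuousOn
  have hx1 : q t₁ ≤ q x := hmax ⟨ht₁.le, hA1.le⟩
  refine ⟨x, hx.1.lt_of_ne fun h => ?_, fun t ht => ?_⟩
  · rw [← h] at hx1
    have : q 0 = 0 := by simp [hq, fourierBorel_zero hK hμ h0]
    linarith
  · rcases le_total t A with h | h
    · exact hmax ⟨ht, h⟩
    · exact (hA t h).le.trans hx1

end Main

end SectorSemigroup

theorem mainTheorem4 {X : Type*} [NormedAddCommGroup X] [NormedSpace ℂ X] [CompleteSpace X]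
    {α β : ℝ} (hβ : 0 < β) (hβα : β < α) (hα : α < Real.pi / 2)
    (T : ℂ → X →L[ℂ] X)
    (hT : SectorSemigroup.IsAnalyticSemigroup α T)
    (hbdd : ∃ M : ℝ, ∀ t ∈ SectorSemigroup.openSector α, ‖T t‖ ≤ M)
    (hquasi : ∀ t ∈ SectorSemigroup.openSector α, spectralRadius ℂ (T t) = 0)
    (hnontriv : ∃ t ∈ SectorSemigroup.openSector α, T t ≠ 0)
    (μ : MeasureTheory.ComplexMeasure ℂ) (K : Set ℂ) (hK : IsCompact K)
    (hKβ : K ⊆ SectorSemigroup.closedSector β)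
    (hsupp : μ.variation Kᶜ = 0) (hmass : μ K = 0) :
    BddAbove ((fun t : ℝ => ‖SectorSemigroup.fourierBorel μ (t : ℂ)‖ ^ 2) '' Set.Ioi 0) ∧
    ∃ η : ℝ, 0 < η ∧ ∀ u ∈ SectorSemigroup.openSector (α - β), ‖u‖ ≤ η →
      sSup ((fun t : ℝ => ‖SectorSemigroup.fourierBorel μ (t : ℂ)‖ ^ 2) '' Set.Ioi 0) ≤
        ‖SectorSemigroup.funcCalc T μ u *
          SectorSemigroup.funcCalc T (SectorSemigroup.conjMeasure μ) u‖ := by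
  open SectorSemigroup Set Filter Topology in
  have h0 : 0 < α := hβ.trans hβα
  have hβ2 : β < Real.pi / 2 := hβα.trans hα
  set F := fourierBorel μ with hF
  set ν := conjMeasure μ with hν
  set K' : Set ℂ := starRingEnd ℂ ⁻¹' K with hK'
  have hK'c : IsCompact K' := Complex.conjLIE.toHomeomorph.isCompact_preimage.2 hK
  have hK'β : K' ⊆ closedSector β := fun ξ hξ => by
    have := conj_mem_closedSector (hKβ hξ)
    rwa [Complex.conj_conj] at this
  have hνsupp : ν.variation K'ᶜ = 0 := variation_conjMeasure_compl hK hsupp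
  have hKre : ∀ ξ ∈ K, 0 < ξ.re := fun ξ hξ => (hKβ hξ).1
  set H : ℂ → ℂ := fun z => F z * fourierBorel ν z with hH
  have hHeq : ∀ z, H z = F z * starRingEnd ℂ (F (starRingEnd ℂ z)) := fun z => by
    rw [hH, hF, ← fourierBorel_conjMeasure]
  have hHreal : ∀ x : ℝ, H x = ((‖F x‖ ^ 2 : ℝ) : ℂ) := fun x => by
    rw [hHeq, Complex.conj_ofReal, Complex.mul_conj, Complex.normSq_eq_norm_sq]
  set S := (fun t : ℝ => ‖F (t : ℂ)‖ ^ 2) '' Ioi 0 with hS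
  -- If `F` vanishes on the positive axis the supremum is `0` and any `η` works.
  by_cases hzero : ∀ t : ℝ, 0 < t → F t = 0
  · have hSz : S ⊆ {0} := by
      rintro _ ⟨t, ht, rfl⟩
      simp [hzero t ht]
    refine ⟨(bddAbove_singleton).mono hSz, 1, one_pos, fun u _ _ => ?_⟩
    refine (Real.sSup_le (fun x hx => ?_) le_rfl).trans (norm_nonneg _)
    exact (hSz hx).le
  push Not at hzero
  obtain ⟨t₁, ht₁, hFt₁⟩ := hzero
  obtain ⟨x₀, hx₀, hmax⟩ :=
    exists_isMaxOn_norm_fourierBorel hK hKre hsupp hmass ht₁ hFt₁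
  have hmax2 : ∀ t : ℝ, 0 ≤ t → ‖F t‖ ^ 2 ≤ ‖F x₀‖ ^ 2 := fun t ht =>
    pow_le_pow_left₀ (norm_nonneg _) (hmax t ht) 2
  have hgreat : IsGreatest S (‖F x₀‖ ^ 2) :=
    ⟨⟨x₀, hx₀, rfl⟩, by rintro _ ⟨t, ht, rfl⟩; exact hmax2 t (le_of_lt ht)⟩
  refine ⟨hgreat.bddAbove, ?_⟩
  rw [hgreat.csSup_eq]
  set c := ‖F x₀‖ ^ 2 with hc
  have hc0 : 0 < c := pow_pos ((norm_pos_iff.2 hFt₁).trans_le (hmax t₁ ht₁.le)) 2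
  obtain ⟨M, hM⟩ := hbdd
  have h1S : (1 : ℂ) ∈ openSector α := by simpa using ofReal_mem_openSector h0 one_pos
  have hM0 : 0 ≤ M := (norm_nonneg _).trans (hM 1 h1S)
  obtain ⟨R, Φ, hRd, hΦd, hΦn, hR⟩ :=
    exists_entire_resolvent h0 hα hT.analytic hT.map_add hM hquasi
  have hR1 : ∀ z, ∀ s ∈ openSector α, R z * (Complex.exp (z * s) • T s) = R z - Φ z s :=
    fun z s hs => (hR z s hs).1
  obtain ⟨ρ, hρ⟩ := hK.isBounded.exists_norm_le
  have hρ1 : ∀ ξ ∈ K, ‖ξ‖ ≤ |ρ| := fun ξ hξ => (hρ ξ hξ).trans (le_abs_self ρ)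
  obtain ⟨C, hCc, hC0, hC⟩ := norm_resolvent_mul_sub_le hα hT.analytic hM0 hM hΦn hR1 hK hKβ
    hρ1 (abs_nonneg ρ) hsupp hK'c hK'β (fun ξ hξ => by
      have := hρ1 _ hξ
      rwa [RCLike.norm_conj] at this) hνsupp
  by_contra! hbad
  -- The bad parameters; the negated conclusion says that they accumulate at `0`.
  set s : Set ℂ := {u | u ∈ openSector (α - β) ∧ ‖funcCalc T μ u * funcCalc T ν u‖ < c} with hs
  have hB : ∀ z : ℂ, 0 ≤ z.im → 0 ≤ (z * Complex.exp (β * Complex.I)).re →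
      ‖H z‖ ≤ μ.variation.real univ * ν.variation.real univ := fun z hz hz' => by
    have e1 := norm_fourierBorel_le hsupp (z := z) (δ := 0) fun ξ hξ =>
      re_mul_nonneg_of_mem_closedSector hβ hβ2 hz hz' (hKβ hξ)
    have e2 := norm_fourierBorel_le hνsupp (z := z) (δ := 0) fun ξ hξ =>
      re_mul_nonneg_of_mem_closedSector hβ hβ2 hz hz' (hK'β hξ)
    rw [neg_zero, Real.exp_zero, one_mul] at e1 e2
    rw [hH, norm_mul]
    exact mul_le_mul e1 e2 (norm_nonneg _) (by positivity)
  obtain ⟨D, hD⟩ := exists_norm_entire_zero_le (H := H) (R := R) (c := c) (x₀ := x₀) (s := s)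
    hβ hβ2
    ((differentiable_fourierBorel hK hsupp).mul (differentiable_fourierBorel hK'c hνsupp))
    (fun z => by rw [hHeq, hHeq, map_mul, Complex.conj_conj, Complex.conj_conj, mul_comm]) hc0
    (fun x hx => by
      rw [hHreal, Complex.norm_real, Real.norm_eq_abs, abs_of_nonneg (by positivity)]
      exact hmax2 x hx)
    hB hx₀ (hHreal x₀)
    ⟨0, by
      have : H 0 = 0 := by rw [hH]; simp [hF, fourierBorel_zero hK hsupp hmass]
      rw [this]
      exact_mod_cast hc0.ne⟩
    hRd hCc
    (fun u hu z => (mul_le_mul_of_nonneg_left (sub_le_sub_left hu.2.le _) (norm_nonneg _)).trans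
      (hC u hu.1 z))
    (fun θ hθ z hz => by
      obtain ⟨D, hD⟩ := eventually_norm_resolvent_le_of_halfPlane hα hβα hM0 hM hΦn hR1 hθ hz
      exact ⟨D, hD.mono fun w hw u hu => hw u hu.1⟩)
  have hR0 : R 0 = 0 := by
    refine norm_le_zero_iff.1 (le_of_forall_pos_le_add fun ε hε => ?_)
    obtain ⟨u, hu, hun, hlt⟩ := hbad (ε / (|D| + 1)) (by positivity)
    calc ‖R 0‖ ≤ D * ‖u‖ := hD u ⟨hu, hlt⟩
      _ ≤ (|D| + 1) * (ε / (|D| + 1)) :=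
        mul_le_mul (by linarith [le_abs_self D]) hun (norm_nonneg _) (by positivity)
      _ = 0 + ε := by field_simp; ring
  -- With `R 0 = 0` the relation `R 0 * T t = R 0 - Φ 0 t` kills the primitive of `T`, and
  -- differentiating it kills `T`.
  have hΦ0 : ∀ t ∈ openSector α, Φ 0 t = 0 := fun t ht => by
    simpa [hR0] using hR1 0 t ht
  obtain ⟨t, ht, hTt⟩ := hnontriv
  apply hTt
  have e1 : HasDerivAt (Φ 0) (T t) t := by simpa using hΦd 0 t ht
  have e2 : HasDerivAt (Φ 0) 0 t := (hasDerivAt_const t (0 : X →L[ℂ] X)).congr_of_eventuallyEq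
    (by filter_upwards [(isOpen_openSector h0 hα).mem_nhds ht] with w hw using hΦ0 w hw)
  exact e1.unique e2
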